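/- Let $d\ge 1$, $\alpha,\beta,M>0$ and $C_1,C_2\in\mathbb R$. Fix a compactly supported Cohen–Daubechies–Vial type orthonormal wavelet basis of $L^2([0,1])$ of regularity $S\in\mathbb N$ with $S>\max(\alpha,\beta)$: for $j\ge J_0$ (where $J_0\ge1$, $2^{J_0}\ge S$) there are orthonormal scaling functions $(\phi_{jm})_{0\le m<2^j}$ and orthonormal wavelets $(\psi_{jm})_{0\le m<2^j}$ in $L^2([0,1])$, obtained from bounded, measurable, compactly supported functions by $x\mapsto 2^{j/2}g(2^jx-m)$ for $S\le m<2^j-S$, and by $x\mapsto 2^{j/2}g^{\mathrm{left}}_m(2^jx)$ and $x\mapsto 2^{j/2}g^{\mathrm{right}}_{2^j-1-m}(2^j(1-x))$ for the first and the last $S$ indices; the spans of the $(\phi_{jm})_m$ increase with $j$, have dense union and contain all polynomials of degree at most $S-1$; and $(\psi_{jm})_m$ spans the orthogonal complement of the span of $(\phi_{jm})_m$ in the span of $(\phi_{j+1,m})_m$. For $m\in\{0,\dots,2^l-1\}^d$ and $\iota\in\{0,1\}^d\setminus\{0\}$ put $\Phi_{lm}(x)=\prod_i\phi_{lm_i}(x_i)$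 and $\Psi^\iota_{lm}(x)=\prod_i\psi^{\iota_i}_{lm_i}(x_i)$, where $\psi^0_{lm}=\phi_{lm}$ and $\psi^1_{lm}=\psi_{lm}$. Let $H(\alpha,M)$ be the set of uniformly continuous $h:[0,1]^d\to\mathbb R$ with $$2^{J_0(\alpha+d/2)}\max_m|\langle h,\Phi_{J_0m}\rangle|+\sup_{l\ge J_0,\,m,\,\iota}2^{l(\alpha+d/2)}|\langle h,\Psi^\iota_{lm}\rangle|\le M.$$ Let $\mathcal P_{(\alpha,\beta)}$ be the set of laws $\mathbb P$ of $(X,A,Y)\in\mathbb R^d\times\mathbb R\times\mathbb R$ such that $X\sim\mathrm{Uniform}([0,1]^d)$, $A,Y\in[C_1,C_2]$ a.s., $p(x)=\mathbb E_{\mathbb P}[A\mid X=x]$ is in $H(\alpha,M)$ and $b(x)=\mathbb E_{\mathbb P}[Y\mid X=x]$ is in $H(\beta,M)$. Put $\psi(\mathbb P)=\mathbb E_{\mathbb P}[\mathrm{Cov}_{\mathbb P}(A,Y\mid X)]$. Given two independent samples $\mathcal D_1,\mathcal D_2$, each consisting of $n\ge 1$ i.i.d. observations from $\mathbb P$, and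 a resolution $k=2^{jd}$ with $j\ge J_0$, let $$\hat b_k(x)=\frac1n\sum_{i\in\mathcal D_1}Y_i\sum_m\Phi_{jm}(X_i)\Phi_{jm}(x),\qquad \hat\psi^{\mathrm{NR}}_k=\frac1n\sum_{i\in\mathcal D_2}A_i\bigl(Y_i-\hat b_k(X_i)\bigr).$$ Then $\hat\psi_k^{\mathrm{NR}}$ is square integrable under every $\mathbb P\in\mathcal P_{(\alpha,\beta)}$, and there is a constant $C>0$, depending on neither $n$ nor $k$, such that for all $n\ge1$ and all $k=2^{jd}$ with $j\ge J_0$ $$\sup_{\mathbb P\in\mathcal P_{(\alpha,\beta)}}\bigl|\mathbb E_{\mathbb P}(\hat\psi^{\mathrm{NR}}_k-\psi(\mathbb P))\bigr|\le C\,k^{-(\alpha+\beta)/d},\qquad \sup_{\mathbb P\in\mathcal P_{(\alpha,\beta)}}\mathrm{Var}_{\mathbb P}(\hat\psi^{\mathrm{NR}}_k)\le C\Bigl(\frac1n+\frac k{n^2}\Bigr).$$ If moreover the model is not degenerate, in the sense that for some $M'<M$ and $\delta>0$ there are functions in $H(\alpha,M')$ and in $H(\beta,M')$ with values in $[C_1+\delta,C_2-\delta]$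 (for instance the zero function, if $C_1<0<C_2$), then there is a constant $c>0$, depending on neither $n$ nor $k$, such that for all $n\ge1$ and all $k=2^{jd}$ with $j\ge J_0$ $$\sup_{\mathbb P\in\mathcal P_{(\alpha,\beta)}}\bigl|\mathbb E_{\mathbb P}(\hat\psi^{\mathrm{NR}}_k-\psi(\mathbb P))\bigr|\ge c\,k^{-(\alpha+\beta)/d}.$$ -/

import Mathlib

open MeasureTheory ProbabilityTheory
open scoped ENNReal

noncomputable section

/-! ### One-dimensional boundary-corrected wavelets on `[0,1]` -/

/-- Lebesgue measure on the unit interval. -/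
def unitVol : Measure ℝ := volume.restrict (Set.Icc 0 1)

/-- The mother functions from which the functions of all levels are obtained: an interior
function on the line, and functions attached to the left and the right end point of the interval
(only finitely many of them are used). -/
structure Generators where
  interior : ℝ → ℝ
  left : ℕ → ℝ → ℝ
  right : ℕ → ℝ → ℝ

/-- The `m`-th function of level `j`, `0 ≤ m < 2 ^ j`: the first `S` and the last `S` indices carry
the dilated functions attached to the two end points, all the others the dilated and translated
interior function `2 ^ (j / 2) g (2 ^ j x - m)`. -/
def Generators.level (g : Generators) (S j : ℕ) (m : Fin (2 ^ j)) (x : ℝ) : ℝ :=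
  Real.sqrt (2 ^ j) *
    (if (m : ℕ) < S then g.left m (2 ^ j * x)
     else if (m : ℕ) + S < 2 ^ j then g.interior (2 ^ j * x - (m : ℕ))
     else g.right (2 ^ j - 1 - m) (2 ^ j * (1 - x)))

/-- The mother functions in use are measurable, bounded by `R` and vanish outside `[-R, R]`. -/
structure Generators.CompactlySupported (g : Generators) (S : ℕ) (R : ℝ) : Prop where
  measurable_interior : Measurable g.interior
  measurable_left : ∀ i < S, Measurable (g.left i)
  measurable_right : ∀ i < S, Measurable (g.right i)
  bound_interior : ∀ x, |g.interior x| ≤ R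
  bound_left : ∀ i < S, ∀ x, |g.left i x| ≤ R
  bound_right : ∀ i < S, ∀ x, |g.right i x| ≤ R
  support_interior : ∀ x, R < |x| → g.interior x = 0
  support_left : ∀ i < S, ∀ x, R < |x| → g.left i x = 0
  support_right : ∀ i < S, ∀ x, R < |x| → g.right i x = 0

/-- A compactly supported orthonormal wavelet basis of Cohen–Daubechies–Vial type of `L²([0,1])`,
of regularity `S` (the scaling spaces contain the polynomials of degree at most `S - 1`, so that the
wavelets have `S` vanishing moments) and with coarsest level `J₀`.
Identities between functions on `[0,1]` are meant almost everywhere. -/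
structure CDVBasis (S : ℕ) where
  /-- the coarsest level -/
  J₀ : ℕ
  one_le_J₀ : 1 ≤ J₀
  le_two_pow_J₀ : S ≤ 2 ^ J₀
  /-- the scaling functions -/
  φ : Generators
  /-- the wavelets -/
  ψ : Generators
  compactlySupported : ∃ R : ℝ, φ.CompactlySupported S R ∧ ψ.CompactlySupported S R
  orthonormal_φ : ∀ j, J₀ ≤ j → ∀ m m' : Fin (2 ^ j),
    ∫ x, φ.level S j m x * φ.level S j m' x ∂unitVol = if m = m' then 1 else 0
  orthonormal_ψ : ∀ j, J₀ ≤ j → ∀ m m' : Fin (2 ^ j),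
    ∫ x, ψ.level S j m x * ψ.level S j m' x ∂unitVol = if m = m' then 1 else 0
  orthogonal : ∀ j, J₀ ≤ j → ∀ m m' : Fin (2 ^ j),
    ∫ x, φ.level S j m x * ψ.level S j m' x ∂unitVol = 0
  /-- each scaling space is contained in the next one -/
  refine_φ : ∀ j, J₀ ≤ j → ∀ m : Fin (2 ^ j), ∃ a : Fin (2 ^ (j + 1)) → ℝ,
    φ.level S j m =ᵐ[unitVol] fun x => ∑ i, a i * φ.level S (j + 1) i x
  /-- the wavelets of a level lie in the next scaling space, where they span, by dimension, the
  orthogonal complement of the scaling space of their level -/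
  refine_ψ : ∀ j, J₀ ≤ j → ∀ m : Fin (2 ^ j), ∃ a : Fin (2 ^ (j + 1)) → ℝ,
    ψ.level S j m =ᵐ[unitVol] fun x => ∑ i, a i * φ.level S (j + 1) i x
  /-- the union of the scaling spaces is dense in `L²([0,1])` -/
  dense : ∀ h : ℝ → ℝ, MemLp h 2 unitVol → ∀ ε > 0, ∃ j, J₀ ≤ j ∧ ∃ a : Fin (2 ^ j) → ℝ,
    ∫ x, (h x - ∑ i, a i * φ.level S j i x) ^ 2 ∂unitVol ≤ ε
  /-- each scaling space contains the polynomials of degree less than `S` -/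
  polynomial : ∀ j, J₀ ≤ j → ∀ r < S, ∃ a : Fin (2 ^ j) → ℝ,
    (fun x : ℝ => x ^ r) =ᵐ[unitVol] fun x => ∑ i, a i * φ.level S j i x

/-! ### The tensor product basis of `L²([0,1]^d)` and Hölder balls -/

/-- The uniform distribution on the unit cube. -/
def cubeVol (d : ℕ) : Measure (Fin d → ℝ) := volume.restrict (Set.Icc 0 1)

namespace CDVBasis

variable {S : ℕ} (W : CDVBasis S) {d : ℕ}

/-- The scaling function `Φ_{l m}` on the cube. -/
def Φ (l : ℕ) (m : Fin d → Fin (2 ^ l)) (x : Fin d → ℝ) : ℝ :=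
  ∏ i, W.φ.level S l (m i) (x i)

/-- The wavelet `Ψ^ι_{l m}` on the cube, where `ι i` selects the wavelet (`true`) or the scaling
function (`false`) in the `i`-th coordinate. -/
def Ψ (l : ℕ) (ι : Fin d → Bool) (m : Fin d → Fin (2 ^ l)) (x : Fin d → ℝ) : ℝ :=
  ∏ i, (if ι i then W.ψ else W.φ).level S l (m i) (x i)

/-- The kernel of the orthogonal projection onto the span `V_j` of the `Φ_{j m}`; this space has
dimension `k = 2 ^ (j d)`. -/
def kernel (j : ℕ) (x y : Fin d → ℝ) : ℝ :=
  ∑ m : Fin d → Fin (2 ^ j), W.Φ j m x * W.Φ j m y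

/-- The weighted supremum norm of the wavelet coefficients which defines the Hölder ball. -/
def holderNorm (α : ℝ) (h : (Fin d → ℝ) → ℝ) : ℝ≥0∞ :=
  (⨆ m : Fin d → Fin (2 ^ W.J₀),
    ENNReal.ofReal ((2 : ℝ) ^ ((W.J₀ : ℝ) * (α + (d : ℝ) / 2)) *
      |∫ x, h x * W.Φ W.J₀ m x ∂cubeVol d|)) +
  ⨆ (l : ℕ) (_ : W.J₀ ≤ l) (ι : Fin d → Bool) (_ : ∃ i, ι i = true) (m : Fin d → Fin (2 ^ l)),
    ENNReal.ofReal ((2 : ℝ) ^ ((l : ℝ) * (α + (d : ℝ) / 2)) *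
      |∫ x, h x * W.Ψ l ι m x ∂cubeVol d|)

/-- The Hölder ball `H(α, M)`. -/
def holderBall (d : ℕ) (α M : ℝ) : Set ((Fin d → ℝ) → ℝ) :=
  {h | UniformContinuousOn h (Set.Icc 0 1) ∧ W.holderNorm α h ≤ ENNReal.ofReal M}

end CDVBasis

/-! ### The model and the functional -/

/-- An observation `O = (X, A, Y)`. -/
abbrev Obs (d : ℕ) : Type := (Fin d → ℝ) × ℝ × ℝ

namespace Obs

variable {d : ℕ}

/-- the covariates -/
def X (o : Obs d) : Fin d → ℝ := o.1

/-- the treatment -/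
def A (o : Obs d) : ℝ := o.2.1

/-- the outcome -/
def Y (o : Obs d) : ℝ := o.2.2

/-- The σ-algebra generated by the covariates. -/
abbrev sigmaX (d : ℕ) : MeasurableSpace (Obs d) := MeasurableSpace.comap X inferInstance

end Obs

/-- The set of distributions `𝒫_(α,β)` of an observation: uniformly distributed covariates,
`A` and `Y` in `[C₁, C₂]` almost surely, and regression functions `p ∈ H(α, M)` of `A` and
`b ∈ H(β, M)` of `Y` on `X`. -/
structure InModel {S d : ℕ} (W : CDVBasis S) (α β M C₁ C₂ : ℝ) (P : Measure (Obs d)) : Prop where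
  prob : IsProbabilityMeasure P
  uniform : P.map Obs.X = cubeVol d
  bounded : ∀ᵐ o ∂P, o.A ∈ Set.Icc C₁ C₂ ∧ o.Y ∈ Set.Icc C₁ C₂
  reg_A : ∃ p ∈ W.holderBall d α M, P[Obs.A | Obs.sigmaX d] =ᵐ[P] fun o => p o.X
  reg_Y : ∃ b ∈ W.holderBall d β M, P[Obs.Y | Obs.sigmaX d] =ᵐ[P] fun o => b o.X

/-- The conditional covariance `Cov_P(A, Y | X)`. -/
def condCovariance {d : ℕ} (P : Measure (Obs d)) : Obs d → ℝ :=
  P[fun o => (o.A - (P[Obs.A | Obs.sigmaX d]) o) * (o.Y - (P[Obs.Y | Obs.sigmaX d]) o)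
    | Obs.sigmaX d]

/-- The functional `ψ(P) = E_P[Cov_P(A, Y | X)]`. -/
def psi {d : ℕ} (P : Measure (Obs d)) : ℝ := ∫ o, condCovariance P o ∂P

/-! ### The estimator -/

/-- The wavelet projection estimator of `b` fitted on the subsample `D`. -/
def bHat {S d n : ℕ} (W : CDVBasis S) (j : ℕ) (D : Fin n → Obs d) (x : Fin d → ℝ) : ℝ :=
  (1 / (n : ℝ)) * ∑ i, (D i).Y * W.kernel j (D i).X x

/-- The Newey–Robins plug-in estimator with single sample splitting: `b` is estimated on the first
subsample, the functional on the second one. -/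
def psiNR {S d : ℕ} (W : CDVBasis S) (j n : ℕ) (D : (Fin n → Obs d) × (Fin n → Obs d)) : ℝ :=
  (1 / (n : ℝ)) * ∑ i, (D.2 i).A * ((D.2 i).Y - bHat W j D.1 (D.2 i).X)

/-- The joint law of two independent samples, each of `n` independent observations from `P`. -/
def sampleLaw {d : ℕ} (P : Measure (Obs d)) (n : ℕ) :
    Measure ((Fin n → Obs d) × (Fin n → Obs d)) :=
  (Measure.pi fun _ => P).prod (Measure.pi fun _ => P)

/-- The bias `E_P(ψ̂ - ψ(P))` of the estimator. -/
def biasNR {S d : ℕ} (W : CDVBasis S) (j n : ℕ) (P : Measure (Obs d)) : ℝ :=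
  ∫ D, (psiNR W j n D - psi P) ∂sampleLaw P n

/-- The supremum over the model of the absolute bias. -/
def worstBias {S : ℕ} (W : CDVBasis S) (d : ℕ) (α β M C₁ C₂ : ℝ) (j n : ℕ) : ℝ≥0∞ :=
  ⨆ (P : Measure (Obs d)) (_ : InModel W α β M C₁ C₂ P), ENNReal.ofReal |biasNR W j n P|

/-- The supremum over the model of the variance (the extended variance is infinite for a
measurable function that is not square integrable). -/
def worstVariance {S : ℕ} (W : CDVBasis S) (d : ℕ) (α β M C₁ C₂ : ℝ) (j n : ℕ) : ℝ≥0∞ :=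
  ⨆ (P : Measure (Obs d)) (_ : InModel W α β M C₁ C₂ P),
    evariance (psiNR W j n) (sampleLaw P n)

/-- The constants do not make the model degenerate: some admissible regression functions lie
strictly inside both the interval `[C₁, C₂]` and the Hölder ball of radius `M`. -/
def Nondegenerate {S : ℕ} (W : CDVBasis S) (d : ℕ) (α β M C₁ C₂ : ℝ) : Prop :=
  ∃ M' < M, ∃ δ > 0,
    (∃ p ∈ W.holderBall d α M', ∀ x ∈ Set.Icc (0 : Fin d → ℝ) 1,
      p x ∈ Set.Icc (C₁ + δ) (C₂ - δ)) ∧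
    (∃ b ∈ W.holderBall d β M', ∀ x ∈ Set.Icc (0 : Fin d → ℝ) 1,
      b x ∈ Set.Icc (C₁ + δ) (C₂ - δ))

end

/-!
Write `Π_j` for the orthogonal projection of `L²([0,1]^d)` onto the span of the `Φ_{j m}`.

*Mean and variance.* Given the first sample, the estimator is a mean of independent summands with
mean `E[A Y] - n⁻¹ ∑ Y_l (Π_j p)(X_l)`. Integrating over the first sample shows that the bias is
`⟨p, (I - Π_j) b⟩` (`biasNR_eq`). The law of total variance reduces the variance to that of two
sample means. The conditional variance involves the mean square of the projection estimator of `b`,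
which is of order `1 + k / n` because its `k` empirical coefficients have variance of order `1 / n`
each; Bessel's inequality does the rest (`variance_psiNR_le`).

*Upper bound on the bias.* In dimension one, the functions `φ_{l m}`, `ψ_{l m}` arise from the
`φ_{l+1,m}` by a square orthogonal matrix, so that the kernel of level `l + 1` is the sum of the
scaling and the wavelet kernels of level `l`; taking products over the coordinates,
`⟨p, (I - Π_l) b⟩ - ⟨p, (I - Π_{l+1}) b⟩` is the sum of `⟨p, Ψ^ι_{l m}⟩ ⟨b, Ψ^ι_{l m}⟩` over `m` and
`ι ≠ 0` (`residual_sub_succ`), which is of order `2 ^ (-l (α + β))`. These terms form a geometric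
series, and `⟨p, (I - Π_J) b⟩ → 0` as `J → ∞` for uniformly continuous `p` and `b`, since `Π_J`
reproduces constants and its kernel concentrates on the diagonal with bounded `L¹` norm
(`tendsto_residual`).

*Lower bound on the bias.* The wavelets need not be continuous, so perturbations of the regression
functions by wavelets may leave the Hölder balls. Cosine waves `cos (π r x₀)` with `r ≤ 2 * 2 ^ j`
serve instead. By Taylor expansion and the vanishing moments, `2 ^ (-j α) cos (π r x₀)` lies in a
Hölder ball of radius independent of `j` and `r` (`exists_scaled_ridge_coeff_le`). There are
`2 * 2 ^ j` such orthogonal waves but only `2 ^ j` scaling functions `φ_{j m}`, so by Bessel's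
inequality one of the waves has at most half of its energy in the span of the `Φ_{j m}`
(`exists_ridge_residual_ge`). Adding it with suitable signs and heights of order `2 ^ (-j α)` and
`2 ^ (-j β)` to interior regression functions gives a bias of order `2 ^ (-j (α + β))`; any pair of
admissible regression functions is attained in the model (`exists_inModel`).
-/

noncomputable section

/-! ### The functions of one level -/

instance : IsProbabilityMeasure unitVol :=
  ⟨by simp [unitVol]⟩

lemma cubeVol_eq_pi (d : ℕ) : cubeVol d = Measure.pi fun _ : Fin d => unitVol := by
  unfold cubeVol unitVol
  rw [← Measure.restrict_pi_pi, ← volume_pi]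
  congr 1
  rw [← Set.pi_univ_Icc]
  rfl

instance (d : ℕ) : IsProbabilityMeasure (cubeVol d) := by
  rw [cubeVol_eq_pi]; infer_instance

namespace Generators.CompactlySupported

variable {g : Generators} {S : ℕ} {R : ℝ}

lemma nonneg (h : g.CompactlySupported S R) : 0 ≤ R :=
  (abs_nonneg _).trans (h.bound_interior 0)

lemma measurable_level (h : g.CompactlySupported S R) (j : ℕ) (m : Fin (2 ^ j)) :
    Measurable (g.level S j m) := by
  have hm := m.2
  unfold Generators.level
  refine Measurable.const_mul ?_ _
  split_ifs with h1 h2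
  · exact (h.measurable_left _ h1).comp (by fun_prop)
  · exact h.measurable_interior.comp (by fun_prop)
  · exact (h.measurable_right _ (by omega)).comp (by fun_prop)

lemma abs_level_le (h : g.CompactlySupported S R) (j : ℕ) (m : Fin (2 ^ j)) (x : ℝ) :
    |g.level S j m x| ≤ √(2 ^ j) * R := by
  have hm := m.2
  unfold Generators.level
  rw [abs_mul, abs_of_nonneg (Real.sqrt_nonneg _)]
  gcongr
  split_ifs with h1 h2
  · exact h.bound_left _ h1 _
  · exact h.bound_interior _
  · exact h.bound_right _ (by omega) _

/-- Every function of level `j` vanishes off an interval of radius `R / 2 ^ j`. -/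
lemma exists_center (h : g.CompactlySupported S R) (j : ℕ) (m : Fin (2 ^ j)) :
    ∃ c : ℝ, ∀ x, g.level S j m x ≠ 0 → |x - c| ≤ R / 2 ^ j := by
  have hm := m.2
  have h2 : (0 : ℝ) < 2 ^ j := by positivity
  unfold Generators.level
  split_ifs with h1 h3
  · refine ⟨0, fun x hx => ?_⟩
    have := mt (h.support_left _ h1 _) (right_ne_zero_of_mul hx)
    rw [not_lt, abs_mul, abs_of_pos h2] at this
    rw [sub_zero, le_div_iff₀ h2]; linarith
  · refine ⟨(m : ℕ) / 2 ^ j, fun x hx => ?_⟩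
    have := mt (h.support_interior _) (right_ne_zero_of_mul hx)
    rw [not_lt] at this
    have e : (2 : ℝ) ^ j * x - (m : ℕ) = 2 ^ j * (x - (m : ℕ) / 2 ^ j) := by field_simp
    rw [e, abs_mul, abs_of_pos h2] at this
    rw [le_div_iff₀ h2]; linarith
  · refine ⟨1, fun x hx => ?_⟩
    have := mt (h.support_right _ (by omega) _) (right_ne_zero_of_mul hx)
    rw [not_lt, abs_mul, abs_of_pos h2] at this
    rw [le_div_iff₀ h2, abs_sub_comm]; linarith

/-- The `L¹` norm of the functions of level `j` is of order `2 ^ (-j / 2)`. -/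
lemma integral_abs_level_le (h : g.CompactlySupported S R) (j : ℕ) (m : Fin (2 ^ j)) :
    ∫ x, |g.level S j m x| ∂unitVol ≤ 2 * R ^ 2 / √(2 ^ j) := by
  obtain ⟨c, hc⟩ := h.exists_center j m
  have h2 : (0 : ℝ) < 2 ^ j := by positivity
  have hR := h.nonneg
  set I := Set.Icc (c - R / 2 ^ j) (c + R / 2 ^ j)
  have hle : ∀ x, |g.level S j m x| ≤ I.indicator (fun _ => √(2 ^ j) * R) x := by
    intro x
    by_cases hx : x ∈ I
    · rw [Set.indicator_of_mem hx]; exact h.abs_level_le j m x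
    · rw [Set.indicator_of_notMem hx]
      have : g.level S j m x = 0 := by
        by_contra h0
        have := abs_le.1 (hc x h0)
        exact hx ⟨by linarith, by linarith⟩
      simp [this]
  calc ∫ x, |g.level S j m x| ∂unitVol
      ≤ ∫ x, I.indicator (fun _ => √(2 ^ j) * R) x ∂unitVol := by
        refine integral_mono_of_nonneg (.of_forall fun x => abs_nonneg _) ?_ (.of_forall hle)
        exact (integrable_const _).indicator measurableSet_Icc
    _ = unitVol.real I * (√(2 ^ j) * R) := by
        rw [integral_indicator measurableSet_Icc]; simp [I]
    _ ≤ (2 * R / 2 ^ j) * (√(2 ^ j) * R) := by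
        gcongr
        have : unitVol.real I ≤ volume.real I := by
          unfold unitVol
          exact ENNReal.toReal_mono (by simp [I]) (Measure.restrict_apply_le _ _)
        refine this.trans (le_of_eq ?_)
        rw [Real.volume_real_Icc_of_le (by have : 0 ≤ R / 2 ^ j := by positivity
                                           linarith)]
        ring
    _ = 2 * R ^ 2 / √(2 ^ j) := by
        have := Real.mul_self_sqrt h2.le
        have h3 : √((2 : ℝ) ^ j) ≠ 0 := by positivity
        rw [div_mul_eq_mul_div, div_eq_div_iff h2.ne' h3]
        linear_combination 2 * R ^ 2 * this

end Generators.CompactlySupported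

/-! ### Finite orthonormal families -/

/-- A finite family of square integrable functions that is orthonormal in `L²(μ)`. -/
structure OrthonormalFamily {Ω ι : Type*} [MeasurableSpace Ω] [DecidableEq ι] (μ : Measure Ω)
    (e : ι → Ω → ℝ) : Prop where
  memLp : ∀ i, MemLp (e i) 2 μ
  inner : ∀ i i', ∫ x, e i x * e i' x ∂μ = if i = i' then 1 else 0

namespace OrthonormalFamily

variable {Ω ι : Type*} [MeasurableSpace Ω] [DecidableEq ι] [Fintype ι] {μ : Measure Ω}
  {e : ι → Ω → ℝ}

lemma memLp_sum (h : OrthonormalFamily μ e) (c : ι → ℝ) :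
    MemLp (fun x => ∑ i, c i * e i x) 2 μ :=
  memLp_finsetSum _ fun i _ => (h.memLp i).const_mul (c i)

lemma integral_mul_sum (h : OrthonormalFamily μ e) {f : Ω → ℝ} (hf : MemLp f 2 μ) (c : ι → ℝ) :
    ∫ x, f x * ∑ i, c i * e i x ∂μ = ∑ i, c i * ∫ x, f x * e i x ∂μ := by
  simp_rw [Finset.mul_sum]
  rw [integral_finsetSum]
  · refine Finset.sum_congr rfl fun i _ => ?_
    rw [← integral_const_mul]
    congr 1; ext x; ring
  · intro i _
    exact hf.integrable_mul ((h.memLp i).const_mul (c i))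

lemma integral_sum_mul (h : OrthonormalFamily μ e) (c : ι → ℝ) (k : ι) :
    ∫ x, (∑ i, c i * e i x) * e k x ∂μ = c k := by
  have := h.integral_mul_sum (h.memLp k) c
  simp_rw [mul_comm (∑ i, c i * e i _)]
  rw [this]
  simp [h.inner]

lemma integral_sum_sq (h : OrthonormalFamily μ e) (c : ι → ℝ) :
    ∫ x, (∑ i, c i * e i x) ^ 2 ∂μ = ∑ i, c i ^ 2 := by
  simp_rw [sq]
  rw [h.integral_mul_sum (h.memLp_sum c) c]
  simp_rw [h.integral_sum_mul]

/-- Bessel's inequality. -/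
lemma sum_sq_le (h : OrthonormalFamily μ e) {f : Ω → ℝ} (hf : MemLp f 2 μ) :
    ∑ i, (∫ x, f x * e i x ∂μ) ^ 2 ≤ ∫ x, f x ^ 2 ∂μ := by
  set c := fun i => ∫ x, f x * e i x ∂μ with hc
  have h0 : 0 ≤ ∫ x, (f x - ∑ i, c i * e i x) ^ 2 ∂μ := integral_nonneg fun x => sq_nonneg _
  have hs := h.memLp_sum c
  have : ∫ x, (f x - ∑ i, c i * e i x) ^ 2 ∂μ
      = ∫ x, f x ^ 2 ∂μ - 2 * ∫ x, f x * ∑ i, c i * e i x ∂μ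
        + ∫ x, (∑ i, c i * e i x) ^ 2 ∂μ := by
    rw [← integral_const_mul, ← integral_sub hf.integrable_sq, ← integral_add]
    · congr 1; ext x; ring
    · exact hf.integrable_sq.sub ((hf.integrable_mul hs).const_mul 2)
    · exact hs.integrable_sq
    · exact (hf.integrable_mul hs).const_mul 2
  rw [this, h.integral_mul_sum hf, h.integral_sum_sq] at h0
  have e1 : ∑ i, c i * ∫ x, f x * e i x ∂μ = ∑ i, c i ^ 2 :=
    Finset.sum_congr rfl fun i _ => by rw [sq]
  rw [e1] at h0
  linarith

end OrthonormalFamily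

/-! ### The tensor product basis -/

namespace CDVBasis

variable {S d : ℕ} (W : CDVBasis S)

/-- The scaling functions (`false`) or the wavelets (`true`). -/
def gen (b : Bool) : Generators := if b then W.ψ else W.φ

@[simp] lemma gen_false : W.gen false = W.φ := rfl

@[simp] lemma gen_true : W.gen true = W.ψ := rfl

lemma exists_support : ∃ R : ℝ, ∀ b, (W.gen b).CompactlySupported S R := by
  obtain ⟨R, h1, h2⟩ := W.compactlySupported
  exact ⟨R, fun b => by cases b <;> assumption⟩

lemma Φ_eq_Ψ (l : ℕ) : (W.Φ l : (Fin d → Fin (2 ^ l)) → _) = W.Ψ l fun _ => false := by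
  ext m x; simp [Φ, Ψ]

lemma Ψ_eq (l : ℕ) (ι : Fin d → Bool) (m : Fin d → Fin (2 ^ l)) (x : Fin d → ℝ) :
    W.Ψ l ι m x = ∏ i, (W.gen (ι i)).level S l (m i) (x i) := rfl

lemma measurable_level (l : ℕ) (b : Bool) (m : Fin (2 ^ l)) :
    Measurable ((W.gen b).level S l m) := by
  obtain ⟨R, hR⟩ := W.exists_support
  exact (hR b).measurable_level l m

lemma memLp_level (l : ℕ) (b : Bool) (m : Fin (2 ^ l)) (q : ℝ≥0∞) :
    MemLp ((W.gen b).level S l m) q unitVol := by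
  obtain ⟨R, hR⟩ := W.exists_support
  exact MemLp.of_bound (W.measurable_level l b m).aestronglyMeasurable _
    (.of_forall fun x => (hR b).abs_level_le l m x)

@[fun_prop]
lemma measurable_Ψ (l : ℕ) (ι : Fin d → Bool) (m : Fin d → Fin (2 ^ l)) :
    Measurable (W.Ψ l ι m) := by
  have := W.measurable_level l
  simp only [funext fun x => W.Ψ_eq l ι m x]
  refine Finset.measurable_prod _ fun i _ => ?_
  exact (this (ι i) (m i)).comp (measurable_pi_apply i)

@[fun_prop]
lemma measurable_Φ (l : ℕ) (m : Fin d → Fin (2 ^ l)) : Measurable (W.Φ l m) := by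
  rw [Φ_eq_Ψ]; fun_prop

lemma exists_abs_Ψ_le (l : ℕ) : ∃ B : ℝ, 0 ≤ B ∧
    ∀ (ι : Fin d → Bool) (m : Fin d → Fin (2 ^ l)) x, |W.Ψ l ι m x| ≤ B := by
  obtain ⟨R, hR⟩ := W.exists_support
  have := (hR true).nonneg
  refine ⟨(√(2 ^ l) * R) ^ d, by positivity, fun ι m x => ?_⟩
  rw [Ψ_eq, Finset.abs_prod]
  refine (Finset.prod_le_prod (fun i _ => abs_nonneg _)
    (fun i _ => (hR (ι i)).abs_level_le l (m i) (x i))).trans ?_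
  simp

lemma memLp_Ψ (l : ℕ) (ι : Fin d → Bool) (m : Fin d → Fin (2 ^ l)) (q : ℝ≥0∞) :
    MemLp (W.Ψ l ι m) q (cubeVol d) := by
  obtain ⟨B, -, hB⟩ := W.exists_abs_Ψ_le (d := d) l
  exact MemLp.of_bound (W.measurable_Ψ l ι m).aestronglyMeasurable B
    (.of_forall fun x => hB ι m x)

lemma memLp_Φ (l : ℕ) (m : Fin d → Fin (2 ^ l)) (q : ℝ≥0∞) : MemLp (W.Φ l m) q (cubeVol d) := by
  rw [Φ_eq_Ψ]; exact W.memLp_Ψ l _ m q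

lemma integral_cubeVol_prod (f : Fin d → ℝ → ℝ) :
    ∫ x, ∏ i, f i (x i) ∂cubeVol d = ∏ i, ∫ t, f i t ∂unitVol := by
  rw [cubeVol_eq_pi]
  exact integral_fintype_prod_eq_prod (μ := fun _ => unitVol) f

lemma orthonormalFamily_φ {j : ℕ} (hj : W.J₀ ≤ j) :
    OrthonormalFamily unitVol (W.φ.level S j) where
  memLp m := W.memLp_level j false m 2
  inner := W.orthonormal_φ j hj

lemma orthonormalFamily_Φ {j : ℕ} (hj : W.J₀ ≤ j) :
    OrthonormalFamily (cubeVol d) (W.Φ j) where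
  memLp m := W.memLp_Φ j m 2
  inner m m' := by
    simp_rw [Φ, ← Finset.prod_mul_distrib]
    rw [integral_cubeVol_prod fun i t => W.φ.level S j (m i) t * W.φ.level S j (m' i) t]
    simp_rw [W.orthonormal_φ j hj]
    rw [Fintype.prod_boole]
    simp [funext_iff]

/-- The `L¹` norms of the functions of level `l` are of order `2 ^ (-l d / 2)`. -/
lemma exists_integral_abs_Ψ_le : ∃ D : ℝ, 0 ≤ D ∧
    ∀ l (ι : Fin d → Bool) (m : Fin d → Fin (2 ^ l)),
      ∫ x, |W.Ψ l ι m x| ∂cubeVol d ≤ (D / √(2 ^ l)) ^ d := by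
  obtain ⟨R, hR⟩ := W.exists_support
  refine ⟨2 * R ^ 2, by positivity, fun l ι m => ?_⟩
  simp_rw [Ψ_eq, Finset.abs_prod]
  rw [integral_cubeVol_prod fun i t => |(W.gen (ι i)).level S l (m i) t|]
  refine (Finset.prod_le_prod (fun i _ => integral_nonneg fun x => abs_nonneg _)
    (fun i _ => (hR (ι i)).integral_abs_level_le l (m i))).trans ?_
  simp [div_pow]

end CDVBasis

/-! ### Sample means -/

section SampleMean

variable {Ω : Type*} [MeasurableSpace Ω] {P : Measure Ω} [IsProbabilityMeasure P] {n : ℕ}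
  {f : Ω → ℝ}

/-- The mean of `f` over a sample. -/
def sampleMean (f : Ω → ℝ) (D : Fin n → Ω) : ℝ := (1 / (n : ℝ)) * ∑ i, f (D i)

lemma MeasureTheory.MemLp.comp_pi_eval (hf : MemLp f 2 P) (i : Fin n) :
    MemLp (fun D : Fin n → Ω => f (D i)) 2 (Measure.pi fun _ => P) :=
  hf.comp_measurePreserving (measurePreserving_eval (fun _ => P) i)

lemma memLp_sampleMean (hf : MemLp f 2 P) :
    MemLp (sampleMean f : (Fin n → Ω) → ℝ) 2 (Measure.pi fun _ => P) :=
  (memLp_finsetSum _ fun i _ => hf.comp_pi_eval i).const_mul _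

lemma integral_sampleMean (hn : 1 ≤ n) (hf : MemLp f 2 P) :
    ∫ D : Fin n → Ω, sampleMean f D ∂(Measure.pi fun _ => P) = ∫ o, f o ∂P := by
  unfold sampleMean
  rw [integral_const_mul, integral_finsetSum]
  · have : ∀ i : Fin n, ∫ D : Fin n → Ω, f (D i) ∂(Measure.pi fun _ => P) = ∫ o, f o ∂P := by
      intro i
      exact integral_comp_eval (μ := fun _ : Fin n => P) hf.aestronglyMeasurable
    simp only [this, Finset.sum_const, Finset.card_univ, Fintype.card_fin, nsmul_eq_mul]
    have : (n : ℝ) ≠ 0 := by positivity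
    field_simp
  · intro i _
    exact (hf.comp_pi_eval i).integrable one_le_two

lemma variance_sampleMean_le (hn : 1 ≤ n) (hf : MemLp f 2 P) :
    Var[(sampleMean f : (Fin n → Ω) → ℝ); Measure.pi fun _ => P]
      ≤ (1 / (n : ℝ)) * ∫ o, f o ^ 2 ∂P := by
  have h := variance_sum_pi (μ := fun _ : Fin n => P) (X := fun _ => f) fun _ => hf
  have e : (sampleMean f : (Fin n → Ω) → ℝ)
      = fun D => (1 / (n : ℝ)) * (∑ i, fun D : Fin n → Ω => f (D i)) D := by
    ext D; simp [sampleMean]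
  rw [e, variance_const_mul, h]
  have hv : Var[f; P] ≤ ∫ o, f o ^ 2 ∂P := variance_le_expectation_sq hf.aestronglyMeasurable
  simp only [Finset.sum_const, Finset.card_univ, Fintype.card_fin, nsmul_eq_mul]
  have : (n : ℝ) ≠ 0 := by positivity
  calc (1 / (n : ℝ)) ^ 2 * (n * Var[f; P]) = (1 / (n : ℝ)) * Var[f; P] := by field_simp
    _ ≤ _ := by gcongr

lemma integral_sampleMean_sq_le (hn : 1 ≤ n) (hf : MemLp f 2 P) :
    ∫ D : Fin n → Ω, sampleMean f D ^ 2 ∂(Measure.pi fun _ => P)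
      ≤ (1 / (n : ℝ)) * ∫ o, f o ^ 2 ∂P + (∫ o, f o ∂P) ^ 2 := by
  have h := variance_sampleMean_le hn hf
  rw [variance_eq_sub (memLp_sampleMean hf), integral_sampleMean hn hf] at h
  simp only [Pi.pow_apply] at h
  linarith

end SampleMean

/-- A one-sided form of the law of total variance: `g` is the conditional mean of `f` given the
first coordinate and `v` dominates its conditional variance. -/
lemma variance_prod_le {Ω Ω' : Type*} [MeasurableSpace Ω] [MeasurableSpace Ω'] {μ : Measure Ω}
    {ν : Measure Ω'} [IsProbabilityMeasure μ] [IsProbabilityMeasure ν] {f : Ω × Ω' → ℝ}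
    {g v : Ω → ℝ} (hf : MemLp f 2 (μ.prod ν)) (hg : MemLp g 2 μ) (hv : Integrable v μ)
    (hfg : ∀ x, ∫ y, f (x, y) ∂ν = g x) (hfv : ∀ x, ∫ y, f (x, y) ^ 2 ∂ν ≤ v x + g x ^ 2) :
    Var[f; μ.prod ν] ≤ ∫ x, v x ∂μ + Var[g; μ] := by
  rw [variance_eq_sub hf, variance_eq_sub hg]
  have h1 : ∫ z, f z ∂(μ.prod ν) = ∫ x, g x ∂μ := by
    rw [integral_prod f (hf.integrable one_le_two)]
    simp_rw [hfg]
  have h2 : ∫ z, (f ^ 2) z ∂(μ.prod ν) ≤ ∫ x, v x ∂μ + ∫ x, (g ^ 2) x ∂μ := by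
    have hi : Integrable (fun z => f z ^ 2) (μ.prod ν) := hf.integrable_sq
    simp only [Pi.pow_apply]
    rw [integral_prod _ hi, ← integral_add hv hg.integrable_sq]
    exact integral_mono hi.integral_prod_left (hv.add hg.integrable_sq) hfv
  rw [h1]
  linarith

/-! ### Regression functions -/

namespace Obs

variable {d : ℕ}

@[fun_prop] lemma measurable_X : Measurable (X : Obs d → _) := measurable_fst

@[fun_prop] lemma measurable_A : Measurable (A : Obs d → _) := measurable_snd.fst

@[fun_prop] lemma measurable_Y : Measurable (Y : Obs d → _) := measurable_snd.snd

end Obs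

lemma sigmaX_le (d : ℕ) : Obs.sigmaX d ≤ (inferInstance : MeasurableSpace (Obs d)) :=
  Obs.measurable_X.comap_le

/-- `f` is a regression function on the covariates of the variable `Z`, which is bounded by `B`. -/
structure IsRegression {d : ℕ} (P : Measure (Obs d)) (B : ℝ) (Z : Obs d → ℝ)
    (f : (Fin d → ℝ) → ℝ) : Prop where
  measurable : Measurable Z
  bound : ∀ᵐ o ∂P, |Z o| ≤ B
  aestronglyMeasurable : AEStronglyMeasurable f (cubeVol d)
  condExp : P[Z | Obs.sigmaX d] =ᵐ[P] fun o => f o.X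

section Regression

variable {d : ℕ} {P : Measure (Obs d)} {B : ℝ}

lemma integral_comp_X (hU : P.map Obs.X = cubeVol d) {g : (Fin d → ℝ) → ℝ}
    (hg : AEStronglyMeasurable g (cubeVol d)) : ∫ o, g o.X ∂P = ∫ x, g x ∂cubeVol d := by
  rw [← hU, integral_map Obs.measurable_X.aemeasurable (by rwa [hU])]

lemma memLp_comp_X (hU : P.map Obs.X = cubeVol d) {g : (Fin d → ℝ) → ℝ} {q : ℝ≥0∞}
    (hg : MemLp g q (cubeVol d)) : MemLp (fun o : Obs d => g o.X) q P := by
  rw [← hU] at hg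
  exact (memLp_map_measure_iff hg.1 Obs.measurable_X.aemeasurable).1 hg

namespace IsRegression

variable {Z : Obs d → ℝ} {f : (Fin d → ℝ) → ℝ}

lemma nonneg [IsProbabilityMeasure P] (h : IsRegression P B Z f) : 0 ≤ B := by
  obtain ⟨o, ho⟩ := h.bound.exists
  exact (abs_nonneg _).trans ho

lemma memLp_Z [IsProbabilityMeasure P] (h : IsRegression P B Z f) (q : ℝ≥0∞) : MemLp Z q P :=
  MemLp.of_bound h.measurable.aestronglyMeasurable B h.bound

lemma memLp_mul [IsProbabilityMeasure P] (h : IsRegression P B Z f) {g : Obs d → ℝ} {q : ℝ≥0∞} (hg : MemLp g q P) :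
    MemLp (fun o => Z o * g o) q P :=
  MemLp.mul hg (h.memLp_Z ⊤)

lemma bound_condExp (h : IsRegression P B Z f) : ∀ᵐ o ∂P, |f o.X| ≤ B := by
  have := ae_bdd_abs_condExp_of_ae_bdd_abs (m := Obs.sigmaX d) h.bound
  filter_upwards [this, h.condExp] with o h1 h2
  rwa [h2] at h1

lemma memLp [IsProbabilityMeasure P] (h : IsRegression P B Z f) (hU : P.map Obs.X = cubeVol d) :
    MemLp f 2 (cubeVol d) := by
  have hm := h.aestronglyMeasurable
  rw [← hU] at hm ⊢
  rw [memLp_map_measure_iff hm Obs.measurable_X.aemeasurable]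
  exact MemLp.of_bound (hm.comp_measurable Obs.measurable_X) B h.bound_condExp

lemma integral_sq_le [IsProbabilityMeasure P] (h : IsRegression P B Z f) (hU : P.map Obs.X = cubeVol d) :
    ∫ x, f x ^ 2 ∂cubeVol d ≤ B ^ 2 := by
  rw [← integral_comp_X hU (g := fun x => f x ^ 2) (h.aestronglyMeasurable.pow 2)]
  calc ∫ o : Obs d, f o.X ^ 2 ∂P ≤ ∫ o : Obs d, B ^ 2 ∂P := by
        refine integral_mono_of_nonneg (.of_forall fun o => sq_nonneg _) (integrable_const _) ?_
        filter_upwards [h.bound_condExp] with o ho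
        exact sq_le_sq.2 (ho.trans (le_abs_self B))
    _ = B ^ 2 := by simp

lemma integral_mul_eq [IsProbabilityMeasure P] (h : IsRegression P B Z f) {G : Obs d → ℝ}
    (hG : StronglyMeasurable[Obs.sigmaX d] G) (hG2 : MemLp G 2 P) :
    ∫ o, Z o * G o ∂P = ∫ o, f o.X * G o ∂P := by
  have hi : Integrable (Z * G) P := (h.memLp_Z 2).integrable_mul hG2
  rw [← integral_condExp (sigmaX_le d) (f := fun o => Z o * G o)]
  refine integral_congr_ae ?_
  have := condExp_mul_of_stronglyMeasurable_right hG hi ((h.memLp_Z 1).integrable le_rfl)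
  filter_upwards [this, h.condExp] with o h1 h2
  change (P[Z * G | Obs.sigmaX d]) o = _
  rw [h1, Pi.mul_apply, h2]

lemma integral_mul_comp [IsProbabilityMeasure P] (h : IsRegression P B Z f) (hU : P.map Obs.X = cubeVol d)
    {g : (Fin d → ℝ) → ℝ} (hg : Measurable g) (hg2 : MemLp g 2 (cubeVol d)) :
    ∫ o, Z o * g o.X ∂P = ∫ x, f x * g x ∂cubeVol d := by
  rw [h.integral_mul_eq (G := fun o => g o.X) _ (memLp_comp_X hU hg2)]
  · exact integral_comp_X hU (h.aestronglyMeasurable.mul hg2.1)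
  · exact (hg.comp (comap_measurable Obs.X)).stronglyMeasurable

end IsRegression

lemma psi_eq [IsProbabilityMeasure P] {p b : (Fin d → ℝ) → ℝ} (hU : P.map Obs.X = cubeVol d)
    (hp : IsRegression P B Obs.A p) (hb : IsRegression P B Obs.Y b) :
    psi P = ∫ o, o.A * o.Y ∂P - ∫ x, p x * b x ∂cubeVol d := by
  set EA := P[Obs.A | Obs.sigmaX d]
  set EY := P[Obs.Y | Obs.sigmaX d]
  have hEA : MemLp EA 2 P := (memLp_comp_X hU (hp.memLp hU)).ae_eq hp.condExp.symm
  have hEY : MemLp EY 2 P := (memLp_comp_X hU (hb.memLp hU)).ae_eq hb.condExp.symm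
  have hA := hp.memLp_Z 2
  have hY := hb.memLp_Z 2
  have hpb : ∫ o : Obs d, p o.X * b o.X ∂P = ∫ x, p x * b x ∂cubeVol d :=
    integral_comp_X hU (hp.aestronglyMeasurable.mul hb.aestronglyMeasurable)
  have h1 : ∫ o, o.A * EY o ∂P = ∫ x, p x * b x ∂cubeVol d := by
    rw [hp.integral_mul_eq stronglyMeasurable_condExp hEY, ← hpb]
    refine integral_congr_ae ?_
    filter_upwards [hb.condExp] with o ho
    rw [ho]
  have h2 : ∫ o, o.Y * EA o ∂P = ∫ x, p x * b x ∂cubeVol d := by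
    rw [hb.integral_mul_eq stronglyMeasurable_condExp hEA, ← hpb]
    refine integral_congr_ae ?_
    filter_upwards [hp.condExp] with o ho
    rw [ho, mul_comm]
  have h3 : ∫ o, EA o * EY o ∂P = ∫ x, p x * b x ∂cubeVol d := by
    rw [← hpb]
    refine integral_congr_ae ?_
    filter_upwards [hp.condExp, hb.condExp] with o ho ho'
    simp only [EA, EY, ho, ho']
  change ∫ o, (P[fun o : Obs d => (o.A - EA o) * (o.Y - EY o) | Obs.sigmaX d]) o ∂P = _
  rw [integral_condExp (sigmaX_le d)]
  have e : ∀ o : Obs d, (o.A - EA o) * (o.Y - EY o)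
      = o.A * o.Y - o.A * EY o - o.Y * EA o + EA o * EY o := fun o => by ring
  simp_rw [e]
  have i1 : Integrable (fun o : Obs d => o.A * o.Y) P := hA.integrable_mul hY
  have i2 : Integrable (fun o : Obs d => o.A * EY o) P := hA.integrable_mul hEY
  have i3 : Integrable (fun o : Obs d => o.Y * EA o) P := hY.integrable_mul hEA
  have i4 : Integrable (fun o : Obs d => EA o * EY o) P := hEA.integrable_mul hEY
  have i12 : Integrable (fun o : Obs d => o.A * o.Y - o.A * EY o) P := i1.sub i2
  have i123 : Integrable (fun o : Obs d => o.A * o.Y - o.A * EY o - o.Y * EA o) P := i12.sub i3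
  rw [integral_add i123 i4, integral_sub i12 i3, integral_sub i1 i2, h1, h2, h3]
  ring

end Regression

/-! ### Mean and variance of the estimator -/

section Estimator

variable {S d : ℕ} (W : CDVBasis S)

/-- The coefficient `⟨f, Φ_{j m}⟩`. -/
def CDVBasis.coeff (j : ℕ) (f : (Fin d → ℝ) → ℝ) (m : Fin d → Fin (2 ^ j)) : ℝ :=
  ∫ x, f x * W.Φ j m x ∂cubeVol d

/-- The bilinear form `⟨p, (I - Π_j) b⟩`, where `Π_j` is the orthogonal projection onto the span of
the `Φ_{j m}`. -/
def CDVBasis.residual (j : ℕ) (p b : (Fin d → ℝ) → ℝ) : ℝ :=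
  ∫ x, p x * b x ∂cubeVol d - ∑ m, W.coeff j p m * W.coeff j b m

/-- The empirical counterpart of the coefficients of the regression function of the outcome. -/
def empCoeff {n : ℕ} (j : ℕ) (m : Fin d → Fin (2 ^ j)) : (Fin n → Obs d) → ℝ :=
  sampleMean fun o : Obs d => o.Y * W.Φ j m o.X

lemma bHat_eq {n : ℕ} (j : ℕ) (D : Fin n → Obs d) (x : Fin d → ℝ) :
    bHat W j D x = ∑ m, empCoeff W j m D * W.Φ j m x := by
  simp only [bHat, CDVBasis.kernel, empCoeff, sampleMean, Finset.mul_sum, Finset.sum_mul]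
  rw [Finset.sum_comm]
  refine Finset.sum_congr rfl fun m _ => Finset.sum_congr rfl fun i _ => ?_
  ring

lemma measurable_empCoeff {n : ℕ} (j : ℕ) (m : Fin d → Fin (2 ^ j)) :
    Measurable (empCoeff W j m : (Fin n → Obs d) → ℝ) := by
  unfold empCoeff sampleMean
  have := W.measurable_Φ (d := d) j m
  fun_prop

lemma measurable_psiNR (j n : ℕ) : Measurable (psiNR W j n (d := d)) := by
  unfold psiNR
  simp_rw [bHat_eq]
  have h1 := fun m => W.measurable_Φ (d := d) j m
  have h2 := fun m => measurable_empCoeff W (d := d) (n := n) j m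
  fun_prop

variable {W} {P : Measure (Obs d)} [IsProbabilityMeasure P] {B : ℝ} {p b : (Fin d → ℝ) → ℝ}

instance (n : ℕ) : IsProbabilityMeasure (sampleLaw P n) := by
  unfold sampleLaw; infer_instance

lemma memLp_psiNR (hp : IsRegression P B Obs.A p) (hb : IsRegression P B Obs.Y b) (j n : ℕ) :
    MemLp (psiNR W j n) 2 (sampleLaw P n) := by
  obtain ⟨K, hK0, hK⟩ := W.exists_abs_Ψ_le (d := d) j
  have hK' : ∀ m x, |W.Φ (d := d) j m x| ≤ K := fun m x => by
    rw [W.Φ_eq_Ψ]; exact hK _ m x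
  have hB := hp.nonneg
  have key : ∀ᵐ D : Fin n → Obs d ∂(Measure.pi fun _ => P),
      ∀ i, |(D i).A| ≤ B ∧ |(D i).Y| ≤ B := by
    rw [ae_all_iff]
    intro i
    exact (Measure.quasiMeasurePreserving_eval (fun _ : Fin n => P) i).ae (hp.bound.and hb.bound)
  have k1 := Measure.quasiMeasurePreserving_fst
    (μ := Measure.pi fun _ : Fin n => P) (ν := Measure.pi fun _ : Fin n => P) |>.ae key
  have k2 := Measure.quasiMeasurePreserving_snd
    (μ := Measure.pi fun _ : Fin n => P) (ν := Measure.pi fun _ : Fin n => P) |>.ae key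
  have hker : ∀ x y, |W.kernel (d := d) j x y|
      ≤ ∑ _m : Fin d → Fin (2 ^ j), K * K := fun x y => by
    refine (Finset.abs_sum_le_sum_abs _ _).trans (Finset.sum_le_sum fun m _ => ?_)
    rw [abs_mul]
    exact mul_le_mul (hK' m x) (hK' m y) (abs_nonneg _) hK0
  set L := ∑ _m : Fin d → Fin (2 ^ j), K * K
  have hL : 0 ≤ L := Finset.sum_nonneg fun _ _ => mul_nonneg hK0 hK0
  refine MemLp.of_bound (measurable_psiNR W j n).aestronglyMeasurable
    ((1 / (n : ℝ)) * ∑ _i : Fin n, B * (B + (1 / (n : ℝ)) * ∑ _i : Fin n, B * L)) ?_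
  filter_upwards [k1, k2] with D h1 h2
  rw [Real.norm_eq_abs, psiNR, abs_mul, abs_of_nonneg (by positivity : 0 ≤ 1 / (n : ℝ))]
  gcongr
  refine (Finset.abs_sum_le_sum_abs _ _).trans (Finset.sum_le_sum fun i _ => ?_)
  rw [abs_mul]
  have hbH : |bHat W j D.1 (D.2 i).X| ≤ (1 / (n : ℝ)) * ∑ _i : Fin n, B * L := by
    rw [bHat, abs_mul, abs_of_nonneg (by positivity : 0 ≤ 1 / (n : ℝ))]
    gcongr
    refine (Finset.abs_sum_le_sum_abs _ _).trans (Finset.sum_le_sum fun i _ => ?_)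
    rw [abs_mul]
    exact mul_le_mul (h1 i).2 (hker _ _) (abs_nonneg _) hB
  refine mul_le_mul (h2 i).1 ?_ (abs_nonneg _) hB
  exact (abs_sub _ _).trans (add_le_add (h2 i).2 hbH)

/-- The contribution of one observation of the second sample, given the first sample. -/
def summand (W : CDVBasis S) {n : ℕ} (j : ℕ) (D : Fin n → Obs d) (o : Obs d) : ℝ :=
  o.A * (o.Y - bHat W j D o.X)

lemma psiNR_eq (j n : ℕ) (D₁ D₂ : Fin n → Obs d) :
    psiNR W j n (D₁, D₂) = sampleMean (summand W j D₁) D₂ := rfl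

lemma measurable_bHat {j n : ℕ} (D : Fin n → Obs d) : Measurable (bHat W j D) := by
  simp only [funext fun x => bHat_eq W j D x]
  fun_prop

lemma memLp_bHat {j n : ℕ} (hj : W.J₀ ≤ j) (D : Fin n → Obs d) :
    MemLp (bHat W j D) 2 (cubeVol d) := by
  simp only [funext fun x => bHat_eq W j D x]
  exact (W.orthonormalFamily_Φ hj).memLp_sum _

lemma memLp_summand {j n : ℕ} (hU : P.map Obs.X = cubeVol d) (hp : IsRegression P B Obs.A p)
    (hb : IsRegression P B Obs.Y b) (hj : W.J₀ ≤ j) (D : Fin n → Obs d) :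
    MemLp (summand W j D) 2 P :=
  hp.memLp_mul ((hb.memLp_Z 2).sub (memLp_comp_X hU (memLp_bHat hj D)))

lemma memLp_weighted {f : (Fin d → ℝ) → ℝ} (hU : P.map Obs.X = cubeVol d)
    (hb : IsRegression P B Obs.Y b) (hf : MemLp f 2 (cubeVol d)) :
    MemLp (fun o : Obs d => o.Y * f o.X) 2 P :=
  hb.memLp_mul (memLp_comp_X hU hf)

lemma integral_weighted_sq_le {f : (Fin d → ℝ) → ℝ} (hU : P.map Obs.X = cubeVol d)
    (hb : IsRegression P B Obs.Y b) (hf : MemLp f 2 (cubeVol d)) :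
    ∫ o : Obs d, (o.Y * f o.X) ^ 2 ∂P ≤ B ^ 2 * ∫ x, f x ^ 2 ∂cubeVol d := by
  rw [← integral_comp_X hU (g := fun x => f x ^ 2) (hf.1.pow 2), ← integral_const_mul]
  refine integral_mono_ae (memLp_weighted hU hb hf).integrable_sq
    ((memLp_comp_X hU hf).integrable_sq.const_mul _) ?_
  filter_upwards [hb.bound] with o ho
  rw [mul_pow]
  exact mul_le_mul_of_nonneg_right (sq_le_sq.2 (ho.trans (le_abs_self B))) (sq_nonneg _)

lemma memLp_empCoeff {j n : ℕ} (hU : P.map Obs.X = cubeVol d) (hb : IsRegression P B Obs.Y b)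
    (m : Fin d → Fin (2 ^ j)) :
    MemLp (empCoeff W j m : (Fin n → Obs d) → ℝ) 2 (Measure.pi fun _ => P) :=
  memLp_sampleMean (memLp_weighted hU hb (W.memLp_Φ j m 2))

/-- The mean square of the projection estimator is at most of order `1 + k / n`. -/
lemma integral_sum_empCoeff_sq_le {j n : ℕ} (hU : P.map Obs.X = cubeVol d)
    (hb : IsRegression P B Obs.Y b) (hj : W.J₀ ≤ j) (hn : 1 ≤ n) :
    ∫ D : Fin n → Obs d, ∑ m, empCoeff W j m D ^ 2 ∂(Measure.pi fun _ => P)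
      ≤ B ^ 2 * 2 ^ (j * d) / n + B ^ 2 := by
  rw [integral_finsetSum _ fun m _ => (memLp_empCoeff hU hb m).integrable_sq]
  have h1 : ∀ m : Fin d → Fin (2 ^ j),
      ∫ D : Fin n → Obs d, empCoeff W j m D ^ 2 ∂(Measure.pi fun _ => P)
        ≤ B ^ 2 / n + W.coeff j b m ^ 2 := by
    intro m
    have hΦ := W.memLp_Φ j m 2
    refine (integral_sampleMean_sq_le hn (memLp_weighted hU hb hΦ)).trans ?_
    rw [hb.integral_mul_comp hU (W.measurable_Φ j m) hΦ]
    have h2 := integral_weighted_sq_le hU hb hΦ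
    have h3 : ∫ x, W.Φ j m x ^ 2 ∂cubeVol d = 1 := by
      have := (W.orthonormalFamily_Φ hj).inner m m
      simpa [sq] using this
    rw [h3, mul_one] at h2
    have : (1 / (n : ℝ)) * ∫ o : Obs d, (o.Y * W.Φ j m o.X) ^ 2 ∂P ≤ B ^ 2 / n := by
      rw [one_div_mul_eq_div]; gcongr
    exact add_le_add this le_rfl
  refine (Finset.sum_le_sum fun m _ => h1 m).trans ?_
  rw [Finset.sum_add_distrib]
  have hbes := ((W.orthonormalFamily_Φ hj).sum_sq_le (hb.memLp hU)).trans (hb.integral_sq_le hU)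
  refine add_le_add (le_of_eq ?_) hbes
  simp [← pow_mul]
  ring

/-- The orthogonal projection of `f` onto the span of the `Φ_{j m}`. -/
def CDVBasis.proj (W : CDVBasis S) (j : ℕ) (f : (Fin d → ℝ) → ℝ) (x : Fin d → ℝ) : ℝ :=
  ∑ m, W.coeff j f m * W.Φ j m x

/-- The mean of the estimator given the first sample. -/
lemma integral_summand {j n : ℕ} (hU : P.map Obs.X = cubeVol d) (hp : IsRegression P B Obs.A p)
    (hb : IsRegression P B Obs.Y b) (hj : W.J₀ ≤ j) (D : Fin n → Obs d) :
    ∫ o, summand W j D o ∂P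
      = ∫ o, o.A * o.Y ∂P - sampleMean (fun o : Obs d => o.Y * W.proj j p o.X) D := by
  have h1 : ∫ o : Obs d, o.A * bHat W j D o.X ∂P
      = sampleMean (fun o : Obs d => o.Y * W.proj j p o.X) D := by
    rw [hp.integral_mul_comp hU (measurable_bHat D) (memLp_bHat hj D)]
    simp_rw [bHat_eq]
    rw [(W.orthonormalFamily_Φ hj).integral_mul_sum (hp.memLp hU)]
    simp only [empCoeff, sampleMean, CDVBasis.proj, Finset.mul_sum, Finset.sum_mul]
    rw [Finset.sum_comm]
    refine Finset.sum_congr rfl fun m _ => Finset.sum_congr rfl fun i _ => ?_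
    unfold CDVBasis.coeff
    ring
  rw [← h1, ← integral_sub]
  · simp [summand, mul_sub]
  · exact (hp.memLp_Z 2).integrable_mul (hb.memLp_Z 2)
  · exact (hp.memLp_Z 2).integrable_mul (memLp_comp_X hU (memLp_bHat hj D))

lemma integral_summand_sq_le {j n : ℕ} (hU : P.map Obs.X = cubeVol d)
    (hp : IsRegression P B Obs.A p) (hb : IsRegression P B Obs.Y b) (hj : W.J₀ ≤ j)
    (D : Fin n → Obs d) :
    ∫ o, summand W j D o ^ 2 ∂P ≤ 2 * B ^ 4 + 2 * B ^ 2 * ∑ m, empCoeff W j m D ^ 2 := by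
  have hm := memLp_bHat hj D
  have h1 : ∫ o : Obs d, bHat W j D o.X ^ 2 ∂P = ∑ m, empCoeff W j m D ^ 2 := by
    rw [integral_comp_X hU (g := fun x => bHat W j D x ^ 2) (hm.1.pow 2)]
    simp_rw [bHat_eq]
    exact (W.orthonormalFamily_Φ hj).integral_sum_sq _
  have hi := (memLp_comp_X hU hm).integrable_sq
  calc ∫ o, summand W j D o ^ 2 ∂P
      ≤ ∫ o : Obs d, (2 * B ^ 4 + 2 * B ^ 2 * bHat W j D o.X ^ 2) ∂P := by
        refine integral_mono_ae (memLp_summand hU hp hb hj D).integrable_sq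
          ((integrable_const _).add (hi.const_mul _)) ?_
        filter_upwards [hp.bound, hb.bound] with o hA hY
        have hA2 : o.A ^ 2 ≤ B ^ 2 := sq_le_sq.2 (hA.trans (le_abs_self B))
        have hY2 : o.Y ^ 2 ≤ B ^ 2 := sq_le_sq.2 (hY.trans (le_abs_self B))
        simp only [summand, mul_pow]
        calc o.A ^ 2 * (o.Y - bHat W j D o.X) ^ 2
            ≤ B ^ 2 * (2 * B ^ 2 + 2 * bHat W j D o.X ^ 2) := by
              gcongr
              nlinarith [sq_nonneg (o.Y + bHat W j D o.X)]
          _ = _ := by ring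
    _ = _ := by
        rw [integral_add (integrable_const _) (hi.const_mul _),
          integral_const_mul (2 * B ^ 2), h1]
        simp

lemma memLp_proj {j : ℕ} (hj : W.J₀ ≤ j) (f : (Fin d → ℝ) → ℝ) :
    MemLp (W.proj j f) 2 (cubeVol d) :=
  (W.orthonormalFamily_Φ hj).memLp_sum _

lemma measurable_proj {j : ℕ} (f : (Fin d → ℝ) → ℝ) : Measurable (W.proj j f) := by
  have := W.measurable_Φ (d := d) j
  unfold CDVBasis.proj
  fun_prop

/-- The bias of the estimator is `⟨p, (I - Π_j) b⟩`. -/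
lemma biasNR_eq {j n : ℕ} (hU : P.map Obs.X = cubeVol d) (hp : IsRegression P B Obs.A p)
    (hb : IsRegression P B Obs.Y b) (hj : W.J₀ ≤ j) (hn : 1 ≤ n) :
    biasNR W j n P = W.residual j p b := by
  have hT := (memLp_psiNR (W := W) hp hb j n).integrable one_le_two
  have hq := memLp_weighted hU hb (memLp_proj (W := W) hj p)
  have h1 : ∫ D, psiNR W j n D ∂sampleLaw P n
      = ∫ o, o.A * o.Y ∂P - ∑ m, W.coeff j p m * W.coeff j b m := by
    rw [sampleLaw] at hT ⊢
    rw [integral_prod _ hT]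
    simp_rw [psiNR_eq, integral_sampleMean hn (memLp_summand hU hp hb hj _),
      integral_summand hU hp hb hj]
    rw [integral_sub (integrable_const _) ((memLp_sampleMean hq).integrable one_le_two),
      integral_sampleMean hn hq,
      hb.integral_mul_comp hU (measurable_proj p) (memLp_proj hj p)]
    unfold CDVBasis.proj
    rw [(W.orthonormalFamily_Φ hj).integral_mul_sum (hb.memLp hU)]
    simp [CDVBasis.coeff]
  rw [biasNR, integral_sub hT (integrable_const _), h1, psi_eq hU hp hb]
  simp [CDVBasis.residual]

/-- The variance of the estimator is at most of order `1 / n + k / n ^ 2`. The term `k / n ^ 2`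
comes from the conditional variance given the first sample. -/
lemma variance_psiNR_le {j n : ℕ} (hU : P.map Obs.X = cubeVol d)
    (hp : IsRegression P B Obs.A p) (hb : IsRegression P B Obs.Y b) (hj : W.J₀ ≤ j) (hn : 1 ≤ n) :
    Var[psiNR W j n; sampleLaw P n] ≤ 5 * B ^ 4 * (1 / (n : ℝ) + 2 ^ (j * d) / (n : ℝ) ^ 2) := by
  have hT := memLp_psiNR (W := W) hp hb j n
  have hq := memLp_weighted hU hb (memLp_proj (W := W) hj p)
  have hqm := memLp_sampleMean (n := n) hq
  set g : (Fin n → Obs d) → ℝ := fun D =>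
    ∫ o, o.A * o.Y ∂P - sampleMean (fun o : Obs d => o.Y * W.proj j p o.X) D with hg
  set v : (Fin n → Obs d) → ℝ := fun D =>
    (1 / (n : ℝ)) * (2 * B ^ 4 + 2 * B ^ 2 * ∑ m, empCoeff W j m D ^ 2) with hv
  have hs : Integrable (fun D : Fin n → Obs d => ∑ m, empCoeff W j m D ^ 2)
      (Measure.pi fun _ => P) :=
    integrable_finsetSum _ fun m _ => (memLp_empCoeff hU hb m).integrable_sq
  have hvi : Integrable v (Measure.pi fun _ => P) :=
    ((integrable_const _).add (hs.const_mul _)).const_mul _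
  have hgm : MemLp g 2 (Measure.pi fun _ => P) := (memLp_const _).sub hqm
  have key : Var[psiNR W j n; sampleLaw P n]
      ≤ ∫ D, v D ∂(Measure.pi fun _ => P) + Var[g; Measure.pi fun _ => P] := by
    refine variance_prod_le hT hgm hvi (fun D => ?_) (fun D => ?_)
    · simp_rw [psiNR_eq]
      rw [integral_sampleMean hn (memLp_summand hU hp hb hj D), integral_summand hU hp hb hj]
    · simp_rw [psiNR_eq]
      refine (integral_sampleMean_sq_le hn (memLp_summand hU hp hb hj D)).trans ?_
      rw [integral_summand hU hp hb hj]
      refine add_le_add ?_ le_rfl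
      exact mul_le_mul_of_nonneg_left (integral_summand_sq_le hU hp hb hj D) (by positivity)
  have hv1 : ∫ D, v D ∂(Measure.pi fun _ => P)
      ≤ (1 / (n : ℝ)) * (2 * B ^ 4 + 2 * B ^ 2 * (B ^ 2 * 2 ^ (j * d) / n + B ^ 2)) := by
    rw [hv, integral_const_mul, integral_add (integrable_const _) (hs.const_mul _),
      integral_const_mul (2 * B ^ 2)]
    have := integral_sum_empCoeff_sq_le (W := W) (n := n) hU hb hj hn
    simp only [integral_const, probReal_univ, one_smul]
    gcongr
  have hg1 : Var[g; Measure.pi fun _ => P] ≤ (1 / (n : ℝ)) * B ^ 4 := by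
    rw [hg, variance_const_sub hqm.1]
    refine (variance_sampleMean_le hn hq).trans ?_
    gcongr
    refine (integral_weighted_sq_le hU hb (memLp_proj hj p)).trans ?_
    have : ∫ x, W.proj j p x ^ 2 ∂cubeVol d ≤ B ^ 2 := by
      unfold CDVBasis.proj
      rw [(W.orthonormalFamily_Φ hj).integral_sum_sq]
      exact ((W.orthonormalFamily_Φ hj).sum_sq_le (hp.memLp hU)).trans (hp.integral_sq_le hU)
    calc B ^ 2 * ∫ x, W.proj j p x ^ 2 ∂cubeVol d ≤ B ^ 2 * B ^ 2 := by gcongr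
      _ = B ^ 4 := by ring
  have hn0 : (n : ℝ) ≠ 0 := by positivity
  calc _ ≤ _ := key
    _ ≤ (1 / (n : ℝ)) * (2 * B ^ 4 + 2 * B ^ 2 * (B ^ 2 * 2 ^ (j * d) / n + B ^ 2))
        + (1 / (n : ℝ)) * B ^ 4 := add_le_add hv1 hg1
    _ = 5 * B ^ 4 * (1 / (n : ℝ)) + 2 * B ^ 4 * (2 ^ (j * d) / (n : ℝ) ^ 2) := by
        field_simp; ring
    _ ≤ 5 * B ^ 4 * (1 / (n : ℝ)) + 5 * B ^ 4 * (2 ^ (j * d) / (n : ℝ) ^ 2) := by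
        gcongr; norm_num
    _ = _ := by ring

end Estimator

/-! ### The two-scale relation -/

namespace CDVBasis

variable {S d : ℕ} (W : CDVBasis S)

/-- The coefficient `⟨f, Ψ^ι_{l m}⟩`. -/
def waveletCoeff (l : ℕ) (ι : Fin d → Bool) (f : (Fin d → ℝ) → ℝ) (m : Fin d → Fin (2 ^ l)) : ℝ :=
  ∫ x, f x * W.Ψ l ι m x ∂cubeVol d

lemma coeff_eq (l : ℕ) (f : (Fin d → ℝ) → ℝ) (m : Fin d → Fin (2 ^ l)) :
    W.coeff l f m = W.waveletCoeff l (fun _ => false) f m := by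
  rw [coeff, waveletCoeff, Φ_eq_Ψ]

/-- The scaling functions and the wavelets of level `l` arise from the scaling functions of level
`l + 1` by a square orthogonal matrix. -/
lemma exists_orthogonal_matrix {l : ℕ} (hl : W.J₀ ≤ l) :
    ∃ Q : Matrix (Bool × Fin (2 ^ l)) (Fin (2 ^ (l + 1))) ℝ, Q.transpose * Q = 1 ∧
      ∀ a m, (W.gen a).level S l m =ᵐ[unitVol]
        fun x => ∑ i, Q (a, m) i * W.φ.level S (l + 1) i x := by
  have h0 : ∀ a m, ∃ c : Fin (2 ^ (l + 1)) → ℝ,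
      (W.gen a).level S l m =ᵐ[unitVol] fun x => ∑ i, c i * W.φ.level S (l + 1) i x := by
    rintro (_ | _) m
    · exact W.refine_φ l hl m
    · exact W.refine_ψ l hl m
  choose c hc using h0
  have ho : OrthonormalFamily unitVol (W.φ.level S (l + 1)) :=
    W.orthonormalFamily_φ (hl.trans l.le_succ)
  refine ⟨Matrix.of fun a i => c a.1 a.2 i, ?_, hc⟩
  refine (Matrix.mul_eq_one_comm_of_card_eq _ _ _ (by simp [pow_succ, mul_comm])).1 ?_
  ext ⟨a, m⟩ ⟨a', m'⟩
  have h1 : ∫ x, (W.gen a).level S l m x * (W.gen a').level S l m' x ∂unitVol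
      = ∑ i, c a m i * c a' m' i := by
    have : ∫ x, (W.gen a).level S l m x * (W.gen a').level S l m' x ∂unitVol
        = ∫ x, (∑ i, c a m i * W.φ.level S (l + 1) i x)
            * ∑ i, c a' m' i * W.φ.level S (l + 1) i x ∂unitVol := by
      refine integral_congr_ae ?_
      filter_upwards [hc a m, hc a' m'] with x h h'
      rw [h, h']
    rw [this, ho.integral_mul_sum (ho.memLp_sum _)]
    simp_rw [ho.integral_sum_mul]
    exact Finset.sum_congr rfl fun i _ => mul_comm _ _
  rw [Matrix.mul_apply, Matrix.one_apply]
  simp only [Matrix.transpose_apply, Matrix.of_apply]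
  rw [← h1]
  rcases a with _ | _ <;> rcases a' with _ | _ <;> simp only [gen_false, gen_true]
  · rw [W.orthonormal_φ l hl]; simp
  · rw [W.orthogonal l hl]; simp
  · simp_rw [mul_comm (W.ψ.level S l m _)]
    rw [W.orthogonal l hl]; simp
  · rw [W.orthonormal_ψ l hl]; simp

/-- The one-dimensional reproducing kernels of two consecutive levels. -/
lemma exists_kernel_succ {l : ℕ} (hl : W.J₀ ≤ l) : ∃ E : Set ℝ, (∀ᵐ t ∂unitVol, t ∈ E) ∧
    ∀ s ∈ E, ∀ t ∈ E,
      ∑ i, W.φ.level S (l + 1) i s * W.φ.level S (l + 1) i t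
        = ∑ a, ∑ m, (W.gen a).level S l m s * (W.gen a).level S l m t := by
  obtain ⟨Q, hQ, hc⟩ := W.exists_orthogonal_matrix hl
  refine ⟨{t | ∀ a m, (W.gen a).level S l m t = ∑ i, Q (a, m) i * W.φ.level S (l + 1) i t},
    ?_, fun s hs t ht => ?_⟩
  · simp only [Set.mem_ofPred_eq]
    rw [ae_all_iff]; intro a
    rw [ae_all_iff]; intro m
    exact hc a m
  · simp only [hs _ _, ht _ _, Finset.sum_mul_sum]
    have hQ' : ∀ i i', ∑ a, ∑ m, Q (a, m) i * Q (a, m) i' = if i = i' then 1 else 0 := by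
      intro i i'
      have := congr_fun (congr_fun hQ i) i'
      rw [Matrix.mul_apply, Matrix.one_apply, Fintype.sum_prod_type] at this
      exact this
    set φ := W.φ.level S (l + 1)
    calc ∑ i, φ i s * φ i t
        = ∑ i, ∑ i', (∑ a, ∑ m, Q (a, m) i * Q (a, m) i') * (φ i s * φ i' t) := by
          simp_rw [hQ']; simp
      _ = ∑ i, ∑ i', ∑ a, ∑ m, Q (a, m) i * φ i s * (Q (a, m) i' * φ i' t) := by
          simp_rw [Finset.sum_mul]
          refine Finset.sum_congr rfl fun i _ => Finset.sum_congr rfl fun i' _ =>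
            Finset.sum_congr rfl fun a _ => Finset.sum_congr rfl fun m _ => by ring
      _ = ∑ i, ∑ a, ∑ m, ∑ i', Q (a, m) i * φ i s * (Q (a, m) i' * φ i' t) := by
          refine Finset.sum_congr rfl fun i _ => ?_
          rw [Finset.sum_comm]
          refine Finset.sum_congr rfl fun a _ => ?_
          rw [Finset.sum_comm]
      _ = _ := by
          rw [Finset.sum_comm]
          refine Finset.sum_congr rfl fun a _ => ?_
          rw [Finset.sum_comm]

lemma ae_cubeVol_forall {E : Set ℝ} (hE : ∀ᵐ t ∂unitVol, t ∈ E) :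
    ∀ᵐ x ∂cubeVol d, ∀ i, x i ∈ E := by
  rw [ae_all_iff]
  intro i
  rw [cubeVol_eq_pi]
  exact (Measure.quasiMeasurePreserving_eval (fun _ : Fin d => unitVol) i).ae hE

/-- A product of coefficients as an integral over the product space. -/
lemma waveletCoeff_mul (l : ℕ) (ι : Fin d → Bool) (f g : (Fin d → ℝ) → ℝ)
    (m : Fin d → Fin (2 ^ l)) : W.waveletCoeff l ι f m * W.waveletCoeff l ι g m
      = ∫ z, (f z.1 * W.Ψ l ι m z.1) * (g z.2 * W.Ψ l ι m z.2)
          ∂(cubeVol d).prod (cubeVol d) :=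
  (integral_prod_mul (fun x => f x * W.Ψ l ι m x) fun x => g x * W.Ψ l ι m x).symm

lemma integrable_waveletCoeff_mul (l : ℕ) (ι : Fin d → Bool) {f g : (Fin d → ℝ) → ℝ}
    (hf : MemLp f 2 (cubeVol d)) (hg : MemLp g 2 (cubeVol d)) (m : Fin d → Fin (2 ^ l)) :
    Integrable (fun z => (f z.1 * W.Ψ l ι m z.1) * (g z.2 * W.Ψ l ι m z.2))
      ((cubeVol d).prod (cubeVol d)) :=
  (hf.integrable_mul (W.memLp_Ψ l ι m 2)).mul_prod (hg.integrable_mul (W.memLp_Ψ l ι m 2))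

/-- Passing to the next level adds the terms of all wavelets of the level. -/
lemma sum_coeff_succ {l : ℕ} (hl : W.J₀ ≤ l) {f g : (Fin d → ℝ) → ℝ}
    (hf : MemLp f 2 (cubeVol d)) (hg : MemLp g 2 (cubeVol d)) :
    ∑ i, W.coeff (l + 1) f i * W.coeff (l + 1) g i
      = ∑ ι, ∑ m, W.waveletCoeff l ι f m * W.waveletCoeff l ι g m := by
  obtain ⟨E, hE, hker⟩ := W.exists_kernel_succ hl
  have hE' := ae_cubeVol_forall (d := d) hE
  simp_rw [coeff_eq, waveletCoeff_mul]
  rw [← integral_finsetSum _ fun i _ => W.integrable_waveletCoeff_mul _ _ hf hg i]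
  simp_rw [← integral_finsetSum _ fun i _ => W.integrable_waveletCoeff_mul _ _ hf hg i]
  rw [← integral_finsetSum _ fun ι _ => integrable_finsetSum _
    fun i _ => W.integrable_waveletCoeff_mul _ _ hf hg i]
  refine integral_congr_ae ?_
  filter_upwards [Measure.quasiMeasurePreserving_fst.ae hE',
    Measure.quasiMeasurePreserving_snd.ae hE'] with z h1 h2
  have e : ∀ l ι (m : Fin d → Fin (2 ^ l)), (f z.1 * W.Ψ l ι m z.1) * (g z.2 * W.Ψ l ι m z.2)
      = f z.1 * g z.2 * ∏ k, (W.gen (ι k)).level S l (m k) (z.1 k)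
        * (W.gen (ι k)).level S l (m k) (z.2 k) := by
    intro l ι m
    rw [Finset.prod_mul_distrib, ← Ψ_eq, ← Ψ_eq]; ring
  simp_rw [e, ← Finset.mul_sum]
  congr 1
  have hp := Finset.prod_congr rfl fun k (_ : k ∈ Finset.univ) => hker _ (h1 k) _ (h2 k)
  rw [Finset.prod_univ_sum, Fintype.piFinset_univ, Finset.prod_univ_sum,
    Fintype.piFinset_univ] at hp
  refine hp.trans (Finset.sum_congr rfl fun ι _ => ?_)
  rw [Finset.prod_univ_sum, Fintype.piFinset_univ]

lemma residual_sub_succ {l : ℕ} (hl : W.J₀ ≤ l) {f g : (Fin d → ℝ) → ℝ}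
    (hf : MemLp f 2 (cubeVol d)) (hg : MemLp g 2 (cubeVol d)) :
    W.residual l f g - W.residual (l + 1) f g
      = ∑ ι ∈ Finset.univ.erase fun _ => false,
          ∑ m, W.waveletCoeff l ι f m * W.waveletCoeff l ι g m := by
  have h := W.sum_coeff_succ hl hf hg
  rw [← Finset.add_sum_erase _ _ (Finset.mem_univ fun _ : Fin d => false)] at h
  simp_rw [← coeff_eq] at h
  rw [residual, residual, h]
  ring

/-! ### Convergence of the projections -/

lemma exists_bound_of_uniformContinuousOn {h : (Fin d → ℝ) → ℝ}
    (hh : UniformContinuousOn h (Set.Icc 0 1)) :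
    ∃ B, 0 ≤ B ∧ ∀ x ∈ Set.Icc (0 : Fin d → ℝ) 1, |h x| ≤ B := by
  obtain ⟨B, hB⟩ := isCompact_Icc.exists_bound_of_continuousOn hh.continuousOn
  exact ⟨max B 0, le_max_right _ _, fun x hx => (hB x hx).trans (le_max_left _ _)⟩

lemma ae_mem_cube : ∀ᵐ x ∂cubeVol d, x ∈ Set.Icc (0 : Fin d → ℝ) 1 :=
  ae_restrict_mem measurableSet_Icc

lemma memLp_of_uniformContinuousOn {h : (Fin d → ℝ) → ℝ}
    (hh : UniformContinuousOn h (Set.Icc 0 1)) (q : ℝ≥0∞) : MemLp h q (cubeVol d) := by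
  obtain ⟨B, -, hB⟩ := exists_bound_of_uniformContinuousOn hh
  refine MemLp.of_bound (hh.continuousOn.aestronglyMeasurable measurableSet_Icc) B ?_
  filter_upwards [ae_mem_cube] with x hx
  exact hB x hx

lemma exists_one_eq_sum (hS : 0 < S) {j : ℕ} (hj : W.J₀ ≤ j) :
    ∃ c : (Fin d → Fin (2 ^ j)) → ℝ, ∀ᵐ x ∂cubeVol d, 1 = ∑ m, c m * W.Φ j m x := by
  obtain ⟨a, ha⟩ := W.polynomial j hj 0 hS
  refine ⟨fun m => ∏ k, a (m k), ?_⟩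
  filter_upwards [ae_cubeVol_forall (d := d) (E := {t | 1 = ∑ i, a i * W.φ.level S j i t})
    (by filter_upwards [ha] with t ht; simpa using ht)] with x hx
  simp_rw [Φ, ← Finset.prod_mul_distrib]
  have := Finset.prod_univ_sum (fun _ : Fin d => (Finset.univ : Finset (Fin (2 ^ j))))
    fun k i => a i * W.φ.level S j i (x k)
  rw [Fintype.piFinset_univ] at this
  rw [← this]
  exact (Finset.prod_eq_one fun k _ => (hx k).symm).symm

/-- As the scaling functions reproduce constants, integrals are sums of coefficients. -/
lemma integral_eq_sum_coeff (hS : 0 < S) {j : ℕ} (hj : W.J₀ ≤ j) {f : (Fin d → ℝ) → ℝ}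
    (hf : MemLp f 2 (cubeVol d)) :
    ∫ x, f x ∂cubeVol d = ∑ m, W.coeff j f m * W.coeff j (fun _ => 1) m := by
  obtain ⟨c, hc⟩ := W.exists_one_eq_sum (d := d) hS hj
  have ho := W.orthonormalFamily_Φ (d := d) hj
  have hc1 : ∀ m, W.coeff j (fun _ => 1) m = c m := by
    intro m
    rw [← ho.integral_sum_mul c m, coeff]
    refine integral_congr_ae ?_
    filter_upwards [hc] with x hx
    rw [← hx]
  calc ∫ x, f x ∂cubeVol d = ∫ x, f x * ∑ m, c m * W.Φ j m x ∂cubeVol d := by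
        refine integral_congr_ae ?_
        filter_upwards [hc] with x hx
        rw [← hx, mul_one]
    _ = _ := by
        rw [ho.integral_mul_sum hf]
        refine Finset.sum_congr rfl fun m _ => ?_
        rw [hc1, mul_comm]; rfl

lemma exists_dist_le_of_Φ_ne_zero : ∃ R : ℝ, ∀ j (m : Fin d → Fin (2 ^ j)) x y,
    W.Φ j m x ≠ 0 → W.Φ j m y ≠ 0 → dist x y ≤ R / 2 ^ j := by
  obtain ⟨R, hR⟩ := W.exists_support
  refine ⟨2 * R, fun j m x y hx hy => ?_⟩
  have hR0 := (hR false).nonneg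
  rw [dist_pi_le_iff (by positivity)]
  intro i
  obtain ⟨c, hc⟩ := (hR false).exists_center j (m i)
  have h1 := abs_le.1 (hc _ (Finset.prod_ne_zero_iff.1 hx i (Finset.mem_univ i)))
  have h2 := abs_le.1 (hc _ (Finset.prod_ne_zero_iff.1 hy i (Finset.mem_univ i)))
  rw [Real.dist_eq, abs_le, mul_div_assoc]
  constructor <;> linarith

/-- For continuous functions the projections onto the scaling spaces converge, since the kernels
concentrate on the diagonal. -/
lemma tendsto_residual (hS : 0 < S) {p b : (Fin d → ℝ) → ℝ}
    (hp : UniformContinuousOn p (Set.Icc 0 1)) (hb : UniformContinuousOn b (Set.Icc 0 1))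
    {ε : ℝ} (hε : 0 < ε) : ∃ J, ∀ j, J ≤ j → W.J₀ ≤ j → |W.residual j p b| ≤ ε := by
  obtain ⟨B, hB0, hB⟩ := exists_bound_of_uniformContinuousOn hp
  obtain ⟨R, hR⟩ := W.exists_dist_le_of_Φ_ne_zero (d := d)
  obtain ⟨D, hD0, hD⟩ := W.exists_integral_abs_Ψ_le (d := d)
  have hp2 := memLp_of_uniformContinuousOn hp
  have hb2 := memLp_of_uniformContinuousOn hb
  obtain ⟨η, hη, hηε⟩ : ∃ η > 0, B * η * (D ^ d) ^ 2 ≤ ε := by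
    refine ⟨ε / (B * (D ^ d) ^ 2 + 1), by positivity, ?_⟩
    rw [mul_assoc, mul_comm _ ((D ^ d) ^ 2), ← mul_assoc, mul_div_assoc',
      div_le_iff₀ (by positivity)]
    nlinarith
  obtain ⟨δ, hδ, hδb⟩ := Metric.uniformContinuousOn_iff.1 hb η hη
  obtain ⟨J, hJ⟩ : ∃ J : ℕ, ∀ j, J ≤ j → R / 2 ^ j < δ := by
    have : Filter.Tendsto (fun j : ℕ => R / 2 ^ j) Filter.atTop (nhds 0) :=
      tendsto_const_nhds.div_atTop (tendsto_pow_atTop_atTop_of_one_lt one_lt_two)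
    exact Filter.eventually_atTop.1 (this.eventually_lt_const hδ)
  refine ⟨J, fun j hj hj0 => ?_⟩
  have hpb : MemLp (fun x => p x * b x) 2 (cubeVol d) := MemLp.mul (hb2 2) (hp2 ⊤)
  have h1 : MemLp (fun _ : Fin d → ℝ => (1 : ℝ)) 2 (cubeVol d) := memLp_const 1
  rw [residual, W.integral_eq_sum_coeff hS hj0 hpb, ← Finset.sum_sub_distrib]
  have hm : ∀ m : Fin d → Fin (2 ^ j),
      |W.coeff j (fun x => p x * b x) m * W.coeff j (fun _ => 1) m - W.coeff j p m * W.coeff j b m|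
        ≤ B * η * ((D / √(2 ^ j)) ^ d) ^ 2 := by
    intro m
    simp_rw [coeff_eq, waveletCoeff_mul]
    rw [← integral_sub (W.integrable_waveletCoeff_mul _ _ hpb h1 m)
      (W.integrable_waveletCoeff_mul _ _ (hp2 2) (hb2 2) m), ← Real.norm_eq_abs]
    have hΨ := (W.memLp_Ψ j (fun _ => false) m 1).integrable le_rfl |>.abs
    have hmono := norm_integral_le_of_norm_le
      (f := fun z : (Fin d → ℝ) × (Fin d → ℝ) =>
        p z.1 * b z.1 * W.Ψ j (fun _ => false) m z.1 * (1 * W.Ψ j (fun _ => false) m z.2)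
        - p z.1 * W.Ψ j (fun _ => false) m z.1 * (b z.2 * W.Ψ j (fun _ => false) m z.2))
      (((hΨ.mul_prod hΨ).const_mul (B * η)))
      (μ := (cubeVol d).prod (cubeVol d)) (by
        filter_upwards [Measure.quasiMeasurePreserving_fst.ae (ae_mem_cube (d := d)),
          Measure.quasiMeasurePreserving_snd.ae (ae_mem_cube (d := d))] with z hz1 hz2
        rw [← W.Φ_eq_Ψ]
        have e : p z.1 * b z.1 * W.Φ j m z.1 * (1 * W.Φ j m z.2)
            - p z.1 * W.Φ j m z.1 * (b z.2 * W.Φ j m z.2)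
            = p z.1 * (b z.1 - b z.2) * (W.Φ j m z.1 * W.Φ j m z.2) := by ring
        rw [e, Real.norm_eq_abs, abs_mul, ← abs_mul (W.Φ j m z.1)]
        by_cases h0 : W.Φ j m z.1 * W.Φ j m z.2 = 0
        · simp [h0]
        refine mul_le_mul_of_nonneg_right ?_ (abs_nonneg _)
        rw [abs_mul]
        have hd := hR j m z.1 z.2 (left_ne_zero_of_mul h0) (right_ne_zero_of_mul h0)
        have := (hδb _ hz1 _ hz2 (hd.trans_lt (hJ j hj))).le
        exact mul_le_mul (hB _ hz1) this (abs_nonneg _) hB0)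
    refine hmono.trans ?_
    rw [integral_const_mul, integral_prod_mul (fun x => |W.Ψ j (fun _ => false) m x|)
      fun x => |W.Ψ j (fun _ => false) m x|, ← sq]
    have := hD j (fun _ => false) m
    gcongr
  refine (Finset.abs_sum_le_sum_abs _ _).trans ((Finset.sum_le_sum fun m _ => hm m).trans ?_)
  refine le_trans (le_of_eq ?_) hηε
  have hs : √((2 : ℝ) ^ j) ^ 2 = 2 ^ j := Real.sq_sqrt (by positivity)
  have : (√((2 : ℝ) ^ j) ^ d) ^ 2 = (2 ^ j) ^ d := by rw [← pow_mul, mul_comm, pow_mul, hs]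
  simp only [Finset.sum_const, Finset.card_univ, Fintype.card_fun, Fintype.card_fin, nsmul_eq_mul]
  rw [div_pow, div_pow, this]
  push_cast
  field_simp

/-! ### The upper bound on the bias -/

lemma abs_waveletCoeff_le {α M : ℝ} (hM : 0 ≤ M) {h : (Fin d → ℝ) → ℝ}
    (hh : h ∈ W.holderBall d α M) {l : ℕ} (hl : W.J₀ ≤ l) {ι : Fin d → Bool}
    (hι : ∃ i, ι i = true) (m : Fin d → Fin (2 ^ l)) :
    (2 : ℝ) ^ ((l : ℝ) * (α + (d : ℝ) / 2)) * |W.waveletCoeff l ι h m| ≤ M := by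
  rw [← ENNReal.ofReal_le_ofReal_iff hM]
  refine le_trans ?_ hh.2
  refine le_trans ?_ le_add_self
  exact le_iSup_of_le l <| le_iSup_of_le hl <| le_iSup_of_le ι <| le_iSup_of_le hι <|
    le_iSup_of_le m le_rfl

lemma abs_residual_sub_succ_le {α β M : ℝ} (hM : 0 ≤ M) {p b : (Fin d → ℝ) → ℝ}
    (hp : p ∈ W.holderBall d α M) (hb : b ∈ W.holderBall d β M) {l : ℕ} (hl : W.J₀ ≤ l) :
    |W.residual l p b - W.residual (l + 1) p b| ≤ 2 ^ d * M ^ 2 * ((2 : ℝ) ^ (-(α + β))) ^ l := by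
  rw [W.residual_sub_succ hl (memLp_of_uniformContinuousOn hp.1 2)
    (memLp_of_uniformContinuousOn hb.1 2)]
  set t : ℝ := M ^ 2 * ((2 : ℝ) ^ (-(α + β))) ^ l / (2 ^ l) ^ d with ht
  have ht0 : 0 ≤ t := by positivity
  have hterm : ∀ ι ∈ Finset.univ.erase (fun _ : Fin d => false), ∀ m,
      |W.waveletCoeff l ι p m * W.waveletCoeff l ι b m| ≤ t := by
    intro ι hι m
    have hι' : ∃ i, ι i = true := by
      by_contra hcon
      push Not at hcon
      exact (Finset.mem_erase.1 hι).1 (funext fun i => by simpa using hcon i)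
    have h1 := W.abs_waveletCoeff_le hM hp hl hι' m
    have h2 := W.abs_waveletCoeff_le hM hb hl hι' m
    have h3 := mul_le_mul h1 h2 (by positivity) hM
    have e : (2 : ℝ) ^ ((l : ℝ) * (α + (d : ℝ) / 2)) * 2 ^ ((l : ℝ) * (β + (d : ℝ) / 2))
        * ((2 : ℝ) ^ (-(α + β))) ^ l = (2 ^ l) ^ d := by
      rw [← Real.rpow_natCast, ← Real.rpow_natCast, ← Real.rpow_natCast, ← Real.rpow_mul two_pos.le,
        ← Real.rpow_mul two_pos.le, ← Real.rpow_add two_pos, ← Real.rpow_add two_pos]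
      congr 1; ring
    rw [ht, le_div_iff₀ (by positivity), ← e, abs_mul]
    have hq : (0 : ℝ) ≤ ((2 : ℝ) ^ (-(α + β))) ^ l := by positivity
    calc _ = _ := ?_
      _ ≤ M * M * ((2 : ℝ) ^ (-(α + β))) ^ l := mul_le_mul_of_nonneg_right h3 hq
      _ = _ := ?_
    all_goals ring
  refine (Finset.abs_sum_le_sum_abs _ _).trans ?_
  calc ∑ ι ∈ Finset.univ.erase (fun _ : Fin d => false),
        |∑ m, W.waveletCoeff l ι p m * W.waveletCoeff l ι b m|
      ≤ ∑ ι ∈ Finset.univ.erase (fun _ : Fin d => false), ∑ _m : Fin d → Fin (2 ^ l), t :=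
        Finset.sum_le_sum fun ι hι => (Finset.abs_sum_le_sum_abs _ _).trans
          (Finset.sum_le_sum fun m _ => hterm ι hι m)
    _ ≤ ∑ _ι : Fin d → Bool, ∑ _m : Fin d → Fin (2 ^ l), t :=
        Finset.sum_le_sum_of_subset_of_nonneg (Finset.subset_univ _) fun _ _ _ =>
          Finset.sum_nonneg fun _ _ => ht0
    _ = 2 ^ d * M ^ 2 * ((2 : ℝ) ^ (-(α + β))) ^ l := by
        simp only [Finset.sum_const, Finset.card_univ, Fintype.card_fun, Fintype.card_fin,
          Fintype.card_bool, nsmul_eq_mul, ht]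
        push_cast
        field_simp

lemma abs_residual_le (hS : 0 < S) {α β M : ℝ} (hα : 0 < α) (hβ : 0 < β) (hM : 0 ≤ M)
    {p b : (Fin d → ℝ) → ℝ} (hp : p ∈ W.holderBall d α M) (hb : b ∈ W.holderBall d β M) {j : ℕ}
    (hj : W.J₀ ≤ j) :
    |W.residual j p b| ≤ 2 ^ d * M ^ 2 / (1 - 2 ^ (-(α + β))) * ((2 : ℝ) ^ (-(α + β))) ^ j := by
  set q : ℝ := (2 : ℝ) ^ (-(α + β)) with hq
  have hq0 : 0 < q := by positivity
  have hq1 : q < 1 := Real.rpow_lt_one_of_one_lt_of_neg one_lt_two (by linarith)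
  set G := 2 ^ d * M ^ 2 / (1 - q) with hG
  have hG0 : 0 ≤ G := div_nonneg (by positivity) (by linarith)
  -- The constant `G` makes the bounds on consecutive differences telescope.
  have hstep : ∀ N, |W.residual j p b| ≤ G * (q ^ j - q ^ (j + N)) + |W.residual (j + N) p b| := by
    intro N
    induction N with
    | zero => simp
    | succ N ih =>
      have h := W.abs_residual_sub_succ_le hM hp hb (hj.trans (j.le_add_right N))
      rw [← hq] at h
      have h2 := abs_sub_abs_le_abs_sub (W.residual (j + N) p b) (W.residual (j + N + 1) p b)
      have e : G * (q ^ (j + N) - q ^ (j + N + 1)) = 2 ^ d * M ^ 2 * q ^ (j + N) := by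
        have : 1 - q ≠ 0 := by linarith
        rw [hG, pow_succ q (j + N)]; field_simp
      rw [← add_assoc]
      linarith
  refine le_of_forall_pos_le_add fun ε hε => ?_
  obtain ⟨J, hJ⟩ := W.tendsto_residual hS hp.1 hb.1 hε
  have h1 := hstep J
  have h2 := hJ (j + J) (J.le_add_left j) (hj.trans (j.le_add_right J))
  have h3 : 0 ≤ G * q ^ (j + J) := by positivity
  linarith

end CDVBasis

/-! ### Cosine waves -/

/-- The function `t ↦ cos (π r t)`. -/
def cosWave (r : ℕ) (t : ℝ) : ℝ := Real.cos (Real.pi * r * t)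

@[fun_prop] lemma continuous_cosWave (r : ℕ) : Continuous (cosWave r) := by
  unfold cosWave; fun_prop

lemma abs_cosWave_le (r : ℕ) (t : ℝ) : |cosWave r t| ≤ 1 := Real.abs_cos_le_one _

lemma memLp_cosWave (r : ℕ) (q : ℝ≥0∞) : MemLp (cosWave r) q unitVol :=
  MemLp.of_bound (continuous_cosWave r).aestronglyMeasurable 1 (.of_forall (abs_cosWave_le r))

lemma integral_cos_pi_int (k : ℤ) :
    ∫ t, Real.cos (Real.pi * k * t) ∂unitVol = if k = 0 then 1 else 0 := by
  split_ifs with hk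
  · simp [hk]
  · have hk' : Real.pi * k ≠ 0 := by
      have := Real.pi_pos.ne'
      have : (k : ℝ) ≠ 0 := by exact_mod_cast hk
      positivity
    rw [unitVol, integral_Icc_eq_integral_Ioc, ← intervalIntegral.integral_of_le zero_le_one,
      intervalIntegral.integral_comp_mul_left _ hk', integral_cos, mul_comm Real.pi]
    simp [Real.sin_int_mul_pi]

lemma integral_cosWave_mul {r r' : ℕ} (hr : 1 ≤ r) :
    ∫ t, cosWave r t * cosWave r' t ∂unitVol = if r = r' then 1 / 2 else 0 := by
  have e : ∀ t, cosWave r t * cosWave r' t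
      = 1 / 2 * (Real.cos (Real.pi * ((r - r' : ℤ) : ℝ) * t)
        + Real.cos (Real.pi * ((r + r' : ℤ) : ℝ) * t)) := by
    intro t
    have h1 : Real.pi * ((r - r' : ℤ) : ℝ) * t = Real.pi * r * t - Real.pi * r' * t := by
      push_cast; ring
    have h2 : Real.pi * ((r + r' : ℤ) : ℝ) * t = Real.pi * r * t + Real.pi * r' * t := by
      push_cast; ring
    rw [h1, h2, Real.cos_sub, Real.cos_add, cosWave, cosWave]; ring
  have hi : ∀ a : ℝ, Integrable (fun t => Real.cos (a * t)) unitVol := fun a =>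
    Integrable.of_bound (by fun_prop) 1 (.of_forall fun t => Real.abs_cos_le_one _)
  simp_rw [e]
  rw [integral_const_mul, integral_add (hi _) (hi _), integral_cos_pi_int, integral_cos_pi_int,
    if_neg (by omega : ¬((r : ℤ) + r' = 0))]
  by_cases h : r = r'
  · simp [h]
  · rw [if_neg h, if_neg (by omega)]; simp

lemma orthonormalFamily_cosWave (N : ℕ) :
    OrthonormalFamily unitVol fun (r : Fin N) t => √2 * cosWave (r + 1) t where
  memLp r := (memLp_cosWave _ 2).const_mul _
  inner r r' := by
    have e : ∀ t, √2 * cosWave (r + 1) t * (√2 * cosWave (r' + 1) t)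
        = 2 * (cosWave (r + 1) t * cosWave (r' + 1) t) := by
      intro t
      have := Real.mul_self_sqrt (zero_le_two : (0 : ℝ) ≤ 2)
      linear_combination (cosWave (r + 1) t * cosWave (r' + 1) t) * this
    simp_rw [e]
    rw [integral_const_mul, integral_cosWave_mul (by omega)]
    by_cases h : r = r'
    · simp [h]
    · rw [if_neg h, if_neg (by omega), mul_zero]

/-- A Taylor polynomial of a cosine. -/
lemma exists_polynomial_cos {S : ℕ} (hS : 0 < S) (a c : ℝ) :
    ∃ q : Polynomial ℝ, q.natDegree < S ∧
      ∀ t, |Real.cos (a * t) - q.eval t| ≤ |a * (t - c)| ^ S * Real.exp |a * (t - c)| := by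
  set z : ℕ → ℂ := fun k =>
    Complex.exp (a * c * Complex.I) * (a * Complex.I) ^ k / (k.factorial : ℂ) with hz
  refine ⟨∑ k ∈ Finset.range S, Polynomial.C (z k).re * (Polynomial.X - Polynomial.C c) ^ k,
    ?_, fun t => ?_⟩
  · refine lt_of_le_of_lt (Polynomial.natDegree_sum_le_of_forall_le (n := S - 1) _ _ fun k hk => ?_)
      (by omega)
    refine (Polynomial.natDegree_C_mul_le _ _).trans ?_
    refine (Polynomial.natDegree_pow_le).trans ?_
    rw [Polynomial.natDegree_X_sub_C, mul_one]
    have := Finset.mem_range.1 hk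
    omega
  · set w : ℂ := ((a * (t - c) : ℝ) : ℂ) * Complex.I with hw
    have hwn : ‖w‖ = |a * (t - c)| := by
      rw [hw, norm_mul, Complex.norm_I, mul_one, Complex.norm_real, Real.norm_eq_abs]
    have h := Complex.norm_exp_sub_sum_le_norm_mul_exp w S
    rw [hwn] at h
    have he : ‖Complex.exp (a * c * Complex.I)‖ = 1 := by
      have := Complex.norm_exp_ofReal_mul_I (a * c)
      push_cast at this
      exact this
    have e1 : Real.cos (a * t) = (Complex.exp (a * c * Complex.I) * Complex.exp w).re := by
      rw [← Complex.exp_add, ← Complex.exp_ofReal_mul_I_re]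
      congr 2
      rw [hw]; push_cast; ring
    have e2 : (∑ k ∈ Finset.range S,
        Polynomial.C (z k).re * (Polynomial.X - Polynomial.C c) ^ k).eval t
        = (Complex.exp (a * c * Complex.I)
            * ∑ k ∈ Finset.range S, w ^ k / (k.factorial : ℂ)).re := by
      rw [Finset.mul_sum, Complex.re_sum, Polynomial.eval_finsetSum]
      refine Finset.sum_congr rfl fun k _ => ?_
      have : Complex.exp (a * c * Complex.I) * (w ^ k / (k.factorial : ℂ))
          = z k * (((t - c) ^ k : ℝ) : ℂ) := by
        have hw' : w = a * Complex.I * ((t - c : ℝ) : ℂ) := by rw [hw]; push_cast; ring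
        rw [hw', hz, mul_pow]; push_cast; ring
      rw [this, Complex.re_mul_ofReal]
      simp
    rw [e1, e2, ← Complex.sub_re, ← mul_sub]
    refine (Complex.abs_re_le_norm _).trans ?_
    rwa [norm_mul, he, one_mul]

namespace CDVBasis

variable {S d : ℕ} (W : CDVBasis S)

/-! ### Wavelet coefficients of cosine waves -/

/-- The vanishing moments of the wavelets. -/
lemma integral_polynomial_mul_ψ {l : ℕ} (hl : W.J₀ ≤ l) (m : Fin (2 ^ l)) {q : Polynomial ℝ}
    (hq : q.natDegree < S) : ∫ t, q.eval t * W.ψ.level S l m t ∂unitVol = 0 := by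
  have hψ : MemLp (W.ψ.level S l m) 2 unitVol := W.memLp_level l true m 2
  have hmon : ∀ r < S, Integrable (fun t => t ^ r * W.ψ.level S l m t) unitVol ∧
      ∫ t, t ^ r * W.ψ.level S l m t ∂unitVol = 0 := by
    intro r hr
    obtain ⟨a, ha⟩ := W.polynomial l hl r hr
    have hae : (fun t => t ^ r * W.ψ.level S l m t) =ᵐ[unitVol]
        fun t => W.ψ.level S l m t * ∑ i, a i * W.φ.level S l i t := by
      filter_upwards [ha] with t ht
      rw [ht, mul_comm]
    constructor
    · exact (hψ.integrable_mul ((W.orthonormalFamily_φ hl).memLp_sum a)).congr hae.symm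
    · rw [integral_congr_ae hae, (W.orthonormalFamily_φ hl).integral_mul_sum hψ]
      refine Finset.sum_eq_zero fun i _ => ?_
      simp_rw [mul_comm (W.ψ.level S l m _)]
      rw [W.orthogonal l hl, mul_zero]
  simp_rw [Polynomial.eval_eq_sum_range' hq, Finset.sum_mul, mul_assoc]
  rw [integral_finsetSum _ fun r hr => (hmon r (Finset.mem_range.1 hr)).1.const_mul _]
  refine Finset.sum_eq_zero fun r hr => ?_
  rw [integral_const_mul, (hmon r (Finset.mem_range.1 hr)).2, mul_zero]

/-- One-dimensional coefficients of a cosine wave of frequency at most `2 * 2 ^ j`: they are of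
order `2 ^ (-l / 2)`, with an additional factor `2 ^ ((j - l) S)` for wavelets of level `l ≥ j`. -/
lemma exists_abs_integral_cosWave_le (hS : 0 < S) : ∃ E : ℝ, 0 ≤ E ∧ ∀ (j r l : ℕ), r ≤ 2 * 2 ^ j →
    W.J₀ ≤ l → ∀ m : Fin (2 ^ l),
      (∀ b, |∫ t, cosWave r t * (W.gen b).level S l m t ∂unitVol| ≤ E / √(2 ^ l)) ∧
      (j ≤ l → |∫ t, cosWave r t * (W.gen true).level S l m t ∂unitVol|
        ≤ E / √(2 ^ l) * ((2 : ℝ) ^ j / 2 ^ l) ^ S) := by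
  obtain ⟨R, hR⟩ := W.exists_support
  have hR0 := (hR false).nonneg
  set y := 2 * Real.pi * R with hy
  have hy0 : 0 ≤ y := by positivity
  set E := 2 * R ^ 2 + y ^ S * Real.exp y * (2 * R ^ 2) with hE
  have hE1 : 2 * R ^ 2 ≤ E := le_add_of_nonneg_right (by positivity)
  have hE2 : y ^ S * Real.exp y * (2 * R ^ 2) ≤ E := le_add_of_nonneg_left (by positivity)
  refine ⟨E, by positivity, fun j r l hr hl m => ⟨fun b => ?_, fun hjl => ?_⟩⟩
  · have hi := ((W.memLp_level l b m 1).integrable le_rfl).abs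
    rw [← Real.norm_eq_abs]
    refine (norm_integral_le_of_norm_le hi (.of_forall fun t => ?_)).trans
      (((hR b).integral_abs_level_le l m).trans (by gcongr))
    rw [Real.norm_eq_abs, abs_mul]
    exact mul_le_of_le_one_left (abs_nonneg _) (abs_cosWave_le r t)
  · obtain ⟨c, hc⟩ := (hR true).exists_center l m
    obtain ⟨q, hq, hqt⟩ := exists_polynomial_cos hS (Real.pi * r) c
    have h2l : (0 : ℝ) < 2 ^ l := by positivity
    set ρ : ℝ := (2 : ℝ) ^ j / 2 ^ l with hρ
    have hρ0 : 0 ≤ ρ := by positivity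
    have hρ1 : ρ ≤ 1 := by
      rw [hρ, div_le_one h2l]; exact pow_le_pow_right₀ one_le_two hjl
    have hi := ((W.memLp_level l true m 1).integrable le_rfl).abs
    have hqi : Integrable (fun t => q.eval t * (W.gen true).level S l m t) unitVol := by
      have hb : MemLp (fun t => q.eval t) 2 unitVol := by
        obtain ⟨K, hK⟩ := (isCompact_Icc (a := (0 : ℝ)) (b := 1)).exists_bound_of_continuousOn
          q.continuous.continuousOn
        refine MemLp.of_bound q.continuous.aestronglyMeasurable K ?_
        filter_upwards [ae_restrict_mem measurableSet_Icc] with t ht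
        exact hK t ht
      exact hb.integrable_mul (W.memLp_level l true m 2)
    have hci : Integrable (fun t => cosWave r t * (W.gen true).level S l m t) unitVol :=
      (memLp_cosWave r 2).integrable_mul (W.memLp_level l true m 2)
    -- The Taylor polynomial at the centre of the support may be subtracted.
    have e : ∫ t, cosWave r t * (W.gen true).level S l m t ∂unitVol
        = ∫ t, (cosWave r t - q.eval t) * (W.gen true).level S l m t ∂unitVol := by
      simp_rw [sub_mul]
      rw [integral_sub hci hqi, gen_true, W.integral_polynomial_mul_ψ hl m hq, sub_zero]
    rw [e, ← Real.norm_eq_abs]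
    refine (norm_integral_le_of_norm_le (hi.const_mul ((y * ρ) ^ S * Real.exp y))
      (.of_forall fun t => ?_)).trans ?_
    · rw [Real.norm_eq_abs, abs_mul]
      by_cases h0 : (W.gen true).level S l m t = 0
      · rw [h0, abs_zero, mul_zero, mul_zero]
      refine mul_le_mul_of_nonneg_right ((hqt t).trans ?_) (abs_nonneg _)
      have hyρ : |Real.pi * r * (t - c)| ≤ y * ρ := by
        rw [abs_mul, abs_of_nonneg (by positivity : 0 ≤ Real.pi * r)]
        have hr' : (r : ℝ) ≤ 2 * 2 ^ j := by exact_mod_cast hr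
        calc Real.pi * r * |t - c| ≤ Real.pi * (2 * 2 ^ j) * (R / 2 ^ l) := by
              gcongr; exact hc t h0
          _ = y * ρ := by rw [hy, hρ]; ring
      gcongr
      exact hyρ.trans (mul_le_of_le_one_right hy0 hρ1)
    · rw [integral_const_mul]
      calc (y * ρ) ^ S * Real.exp y * ∫ t, |(W.gen true).level S l m t| ∂unitVol
          ≤ (y * ρ) ^ S * Real.exp y * (2 * R ^ 2 / √(2 ^ l)) := by
            gcongr; exact (hR true).integral_abs_level_le l m
        _ = y ^ S * Real.exp y * (2 * R ^ 2) / √(2 ^ l) * ρ ^ S := by rw [mul_pow]; ring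
        _ ≤ E / √(2 ^ l) * ρ ^ S := by gcongr

/-- The cosine wave of frequency `r` in the direction of the coordinate `i₀`. -/
def ridge (i₀ : Fin d) (r : ℕ) (x : Fin d → ℝ) : ℝ := cosWave r (x i₀)

lemma ridge_eq (i₀ : Fin d) (r : ℕ) (x : Fin d → ℝ) :
    ridge i₀ r x = ∏ i, cosWave (if i = i₀ then r else 0) (x i) := by
  rw [Finset.prod_eq_single i₀]
  · simp [ridge]
  · intro i _ hi; simp [hi, cosWave]
  · simp

lemma waveletCoeff_ridge (l : ℕ) (ι : Fin d → Bool) (i₀ : Fin d) (r : ℕ)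
    (m : Fin d → Fin (2 ^ l)) : W.waveletCoeff l ι (ridge i₀ r) m
      = ∏ i, ∫ t, cosWave (if i = i₀ then r else 0) t
          * (W.gen (ι i)).level S l (m i) t ∂unitVol := by
  rw [waveletCoeff, ← integral_cubeVol_prod]
  simp_rw [ridge_eq, Ψ_eq, Finset.prod_mul_distrib]

lemma two_rpow_mul_sqrt_pow (l : ℕ) (α : ℝ) :
    (2 : ℝ) ^ ((l : ℝ) * (α + (d : ℝ) / 2)) = ((2 : ℝ) ^ l) ^ α * √(2 ^ l) ^ d := by
  rw [Real.sqrt_eq_rpow, ← Real.rpow_natCast (_ ^ _) d, ← Real.rpow_mul (by positivity),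
    ← Real.rpow_add (by positivity), ← Real.rpow_natCast, ← Real.rpow_mul two_pos.le]
  congr 2; ring

/-- The scaled cosine wave `2 ^ (-j α) cos (π r x_{i₀})` with `r ≤ 2 * 2 ^ j` has bounded norm. -/
lemma exists_scaled_ridge_coeff_le {α : ℝ} (hα : 0 < α) (hαS : α < S) (i₀ : Fin d) :
    ∃ C : ℝ, 0 ≤ C ∧ ∀ (j r l : ℕ), r ≤ 2 * 2 ^ j → W.J₀ ≤ l → ∀ (ι : Fin d → Bool)
      (m : Fin d → Fin (2 ^ l)), (l ≤ j ∨ ∃ i, ι i = true) →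
      (2 : ℝ) ^ ((l : ℝ) * (α + (d : ℝ) / 2)) * |W.waveletCoeff l ι (ridge i₀ r) m|
        ≤ C * ((2 : ℝ) ^ j) ^ α := by
  have hS : 0 < S := by exact_mod_cast hα.trans hαS
  obtain ⟨E, hE0, hE⟩ := W.exists_abs_integral_cosWave_le hS
  refine ⟨E ^ d, by positivity, fun j r l hr hl ι m hcase => ?_⟩
  have hr' : ∀ i, (if i = i₀ then r else 0) ≤ 2 * 2 ^ j := fun i => by split_ifs <;> omega
  have h2l : (0 : ℝ) < 2 ^ l := by positivity
  have h2j : (0 : ℝ) < 2 ^ j := by positivity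
  have hs : 0 < √((2 : ℝ) ^ l) := by positivity
  rw [waveletCoeff_ridge, Finset.abs_prod, two_rpow_mul_sqrt_pow]
  by_cases hlj : l ≤ j
  -- At coarse levels the `L¹` norms of the basis functions suffice.
  · have h1 := Finset.prod_le_prod (s := Finset.univ) (fun i _ => abs_nonneg _)
      fun i _ => (hE j _ l (hr' i) hl (m i)).1 (ι i)
    rw [Finset.prod_const, Finset.card_univ, Fintype.card_fin] at h1
    calc _ ≤ ((2 : ℝ) ^ l) ^ α * √(2 ^ l) ^ d * (E / √(2 ^ l)) ^ d := by gcongr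
      _ = E ^ d * ((2 : ℝ) ^ l) ^ α := by rw [div_pow]; field_simp
      _ ≤ E ^ d * ((2 : ℝ) ^ j) ^ α := by gcongr; norm_num
  -- At fine levels a coordinate that carries a wavelet gains `ρ ^ S ≤ ρ ^ α`. If this is not the
  -- coordinate `i₀`, the wave is constant along it, a cosine wave of frequency `0`.
  · obtain ⟨i₁, hi₁⟩ := hcase.resolve_left hlj
    push Not at hlj
    set ρ : ℝ := (2 : ℝ) ^ j / 2 ^ l with hρ
    have hρ0 : 0 < ρ := by positivity
    have hρ1 : ρ ≤ 1 := by
      rw [hρ, div_le_one h2l]; exact pow_le_pow_right₀ one_le_two hlj.le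
    have h1 := Finset.prod_le_prod (s := Finset.univ) (fun i _ => abs_nonneg _)
      fun i _ => show |∫ t, cosWave (if i = i₀ then r else 0) t
          * (W.gen (ι i)).level S l (m i) t ∂unitVol|
          ≤ E / √(2 ^ l) * (if i = i₁ then ρ ^ S else 1) by
        by_cases hi : i = i₁
        · rw [if_pos hi, hi, hi₁]; exact (hE j _ l (hr' i₁) hl (m i₁)).2 hlj.le
        · rw [if_neg hi, mul_one]; exact (hE j _ l (hr' i) hl (m i)).1 (ι i)
    rw [Finset.prod_mul_distrib, Finset.prod_const, Finset.card_univ, Fintype.card_fin,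
      Finset.prod_ite_eq' Finset.univ i₁, if_pos (Finset.mem_univ _)] at h1
    have hρα : ρ ^ S ≤ ρ ^ α := by
      rw [← Real.rpow_natCast]
      exact Real.rpow_le_rpow_of_exponent_ge hρ0 hρ1 hαS.le
    calc _ ≤ ((2 : ℝ) ^ l) ^ α * √(2 ^ l) ^ d * ((E / √(2 ^ l)) ^ d * ρ ^ α) := by
          gcongr; exact h1.trans (by gcongr)
      _ = E ^ d * (((2 : ℝ) ^ l) ^ α * ρ ^ α) := by rw [div_pow]; field_simp
      _ = E ^ d * ((2 : ℝ) ^ j) ^ α := by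
          rw [← Real.mul_rpow h2l.le hρ0.le, hρ, mul_div_cancel₀ _ h2l.ne']

/-! ### Perturbations inside the Hölder ball -/

lemma continuous_ridge (i₀ : Fin d) (r : ℕ) : Continuous (ridge i₀ r) := by
  unfold ridge; fun_prop

lemma memLp_ridge (i₀ : Fin d) (r : ℕ) (q : ℝ≥0∞) : MemLp (ridge i₀ r) q (cubeVol d) :=
  MemLp.of_bound (continuous_ridge i₀ r).aestronglyMeasurable 1
    (.of_forall fun x => abs_cosWave_le r (x i₀))

lemma waveletCoeff_add_smul (l : ℕ) (ι : Fin d → Bool) {f g : (Fin d → ℝ) → ℝ}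
    (hf : MemLp f 2 (cubeVol d)) (hg : MemLp g 2 (cubeVol d)) (a : ℝ) (m : Fin d → Fin (2 ^ l)) :
    W.waveletCoeff l ι (fun x => f x + a * g x) m
      = W.waveletCoeff l ι f m + a * W.waveletCoeff l ι g m := by
  have hΨ := W.memLp_Ψ l ι m 2
  simp only [waveletCoeff, add_mul, mul_assoc]
  have hi : Integrable (fun x => f x * W.Ψ l ι m x) (cubeVol d) := hf.integrable_mul hΨ
  have hi' : Integrable (fun x => a * (g x * W.Ψ l ι m x)) (cubeVol d) :=
    (hg.integrable_mul hΨ).const_mul a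
  rw [integral_add hi hi', integral_const_mul]

lemma holderNorm_add_smul_le {α : ℝ} {f g : (Fin d → ℝ) → ℝ} (hf : MemLp f 2 (cubeVol d))
    (hg : MemLp g 2 (cubeVol d)) {a K : ℝ}
    (hK : ∀ l, W.J₀ ≤ l → ∀ (ι : Fin d → Bool) (m : Fin d → Fin (2 ^ l)),
      (l ≤ W.J₀ ∨ ∃ i, ι i = true) →
      (2 : ℝ) ^ ((l : ℝ) * (α + (d : ℝ) / 2)) * (|a| * |W.waveletCoeff l ι g m|) ≤ K) :
    W.holderNorm α (fun x => f x + a * g x)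
      ≤ W.holderNorm α f + (ENNReal.ofReal K + ENNReal.ofReal K) := by
  have key : ∀ l, W.J₀ ≤ l → ∀ (ι : Fin d → Bool) (m : Fin d → Fin (2 ^ l)),
      (l ≤ W.J₀ ∨ ∃ i, ι i = true) →
      ENNReal.ofReal ((2 : ℝ) ^ ((l : ℝ) * (α + (d : ℝ) / 2)) *
          |W.waveletCoeff l ι (fun x => f x + a * g x) m|)
        ≤ ENNReal.ofReal ((2 : ℝ) ^ ((l : ℝ) * (α + (d : ℝ) / 2)) * |W.waveletCoeff l ι f m|)
          + ENNReal.ofReal K := by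
    intro l hl ι m h
    refine le_trans (ENNReal.ofReal_le_ofReal ?_) ENNReal.ofReal_add_le
    rw [W.waveletCoeff_add_smul l ι hf hg]
    have h1 := abs_add_le (W.waveletCoeff l ι f m) (a * W.waveletCoeff l ι g m)
    rw [abs_mul] at h1
    have h2 := hK l hl ι m h
    have h3 := mul_le_mul_of_nonneg_left h1
      (by positivity : 0 ≤ (2 : ℝ) ^ ((l : ℝ) * (α + (d : ℝ) / 2)))
    linarith
  unfold holderNorm
  rw [add_add_add_comm]
  refine add_le_add (iSup_le fun m => ?_) (iSup_le fun l => iSup_le fun hl => iSup_le fun ι =>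
    iSup_le fun hι => iSup_le fun m => ?_)
  · have := key W.J₀ le_rfl (fun _ => false) m (.inl le_rfl)
    simp_rw [← coeff_eq] at this
    refine this.trans (add_le_add ?_ le_rfl)
    exact le_iSup_of_le m le_rfl
  · refine (key l hl ι m (.inr hι)).trans (add_le_add ?_ le_rfl)
    exact le_iSup_of_le l <| le_iSup_of_le hl <| le_iSup_of_le ι <| le_iSup_of_le hι <|
      le_iSup_of_le m le_rfl

/-- A function inside a smaller Hölder ball may be perturbed by cosine waves of height
`η 2 ^ (-j α)` and frequency of order `2 ^ j`. -/
lemma exists_perturbation {α M M' : ℝ} (hα : 0 < α) (hαS : α < S) (hM : 0 < M) (hM' : M' < M)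
    (i₀ : Fin d) {f : (Fin d → ℝ) → ℝ} (hf : f ∈ W.holderBall d α M') :
    ∃ η₀ > 0, ∀ (j r : ℕ), W.J₀ ≤ j → r ≤ 2 * 2 ^ j → ∀ a : ℝ, |a| * ((2 : ℝ) ^ j) ^ α ≤ η₀ →
      (fun x => f x + a * ridge i₀ r x) ∈ W.holderBall d α M := by
  obtain ⟨C, hC0, hC⟩ := W.exists_scaled_ridge_coeff_le hα hαS i₀
  have hM1 : max M' 0 < M := max_lt hM' hM
  refine ⟨(M - max M' 0) / (2 * C + 1), by have := sub_pos.2 hM1; positivity,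
    fun j r hj hr a ha => ⟨?_, ?_⟩⟩
  · exact isCompact_Icc.uniformContinuousOn_of_continuous
      (hf.1.continuousOn.add ((continuous_ridge i₀ r).const_mul a).continuousOn)
  · set K := (M - max M' 0) / 2 with hK
    have hK0 : 0 < K := by rw [hK]; linarith
    have h := W.holderNorm_add_smul_le (α := α) (memLp_of_uniformContinuousOn hf.1 2)
      (memLp_ridge i₀ r 2) (a := a) (K := K) (by
        intro l hl ι m hι
        have h1 := hC j r l hr hl ι m (hι.imp_left fun h => h.trans hj)
        calc (2 : ℝ) ^ ((l : ℝ) * (α + (d : ℝ) / 2)) * (|a| * |W.waveletCoeff l ι (ridge i₀ r) m|)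
            = |a| * ((2 : ℝ) ^ ((l : ℝ) * (α + (d : ℝ) / 2))
                * |W.waveletCoeff l ι (ridge i₀ r) m|) := by ring
          _ ≤ |a| * (C * ((2 : ℝ) ^ j) ^ α) := by gcongr
          _ = C * (|a| * ((2 : ℝ) ^ j) ^ α) := by ring
          _ ≤ C * ((M - max M' 0) / (2 * C + 1)) := by gcongr
          _ ≤ K := by
            rw [hK, mul_div_assoc', div_le_div_iff₀ (by positivity) two_pos]
            nlinarith [sub_pos.2 hM1])
    refine h.trans ?_
    calc _ ≤ ENNReal.ofReal (max M' 0) + (ENNReal.ofReal K + ENNReal.ofReal K) := by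
          gcongr
          exact hf.2.trans (ENNReal.ofReal_le_ofReal (le_max_left _ _))
      _ = ENNReal.ofReal M := by
          rw [← ENNReal.ofReal_add hK0.le hK0.le,
            ← ENNReal.ofReal_add (le_max_right _ _) (by linarith)]
          congr 1; rw [hK]; ring

/-! ### A cosine wave far from the scaling space -/

/-- There are twice as many frequencies up to `2 * 2 ^ j` as scaling functions of level `j`, so
that one of these cosine waves has at most half of its energy in the scaling space. -/
lemma exists_cosWave_coeff_le {j : ℕ} (hj : W.J₀ ≤ j) : ∃ r : ℕ, 1 ≤ r ∧ r ≤ 2 * 2 ^ j ∧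
    ∑ m, (∫ t, cosWave r t * W.φ.level S j m t ∂unitVol) ^ 2 ≤ 1 / 4 := by
  by_contra hcon
  push Not at hcon
  have ho := orthonormalFamily_cosWave (2 * 2 ^ j)
  have hφ := W.orthonormalFamily_φ hj
  have h1 : ∑ m, ∑ r : Fin (2 * 2 ^ j),
      (∫ t, W.φ.level S j m t * (√2 * cosWave (r + 1) t) ∂unitVol) ^ 2
      ≤ ∑ _m : Fin (2 ^ j), (1 : ℝ) := by
    refine Finset.sum_le_sum fun m _ => (ho.sum_sq_le (hφ.memLp m)).trans (le_of_eq ?_)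
    simp_rw [sq, hφ.inner, if_true]
  rw [Finset.sum_comm] at h1
  have h2 : ∑ _r : Fin (2 * 2 ^ j), (1 / 2 : ℝ) < ∑ r : Fin (2 * 2 ^ j), ∑ m,
      (∫ t, W.φ.level S j m t * (√2 * cosWave (r + 1) t) ∂unitVol) ^ 2 := by
    refine Finset.sum_lt_sum_of_nonempty ⟨⟨0, by positivity⟩, Finset.mem_univ _⟩ fun r _ => ?_
    have h3 := hcon (r + 1) (by omega) (by omega)
    have e : ∀ m, (∫ t, W.φ.level S j m t * (√2 * cosWave (r + 1) t) ∂unitVol) ^ 2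
        = 2 * (∫ t, cosWave (r + 1) t * W.φ.level S j m t ∂unitVol) ^ 2 := by
      intro m
      have : ∀ t, W.φ.level S j m t * (√2 * cosWave (r + 1) t)
          = √2 * (cosWave (r + 1) t * W.φ.level S j m t) := fun t => by ring
      simp_rw [this]
      rw [integral_const_mul, mul_pow, Real.sq_sqrt zero_le_two]
    simp_rw [e]
    rw [← Finset.mul_sum]
    linarith
  have h4 := h2.trans_le h1
  simp only [Finset.sum_const, Finset.card_univ, Fintype.card_fin, nsmul_eq_mul] at h4
  push_cast at h4
  linarith

lemma exists_ridge_residual_ge {j : ℕ} (hj : W.J₀ ≤ j) (i₀ : Fin d) :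
    ∃ r : ℕ, r ≤ 2 * 2 ^ j ∧ 1 / 4 ≤ W.residual j (ridge i₀ r) (ridge i₀ r) := by
  obtain ⟨r, hr1, hr2, hr⟩ := W.exists_cosWave_coeff_le hj
  refine ⟨r, hr2, ?_⟩
  have hint : ∫ x, ridge i₀ r x * ridge i₀ r x ∂cubeVol d = 1 / 2 := by
    have := integral_cosWave_mul (r := r) (r' := r) hr1
    rw [if_pos rfl] at this
    rw [← this, cubeVol_eq_pi]
    exact integral_comp_eval (μ := fun _ : Fin d => unitVol) (i := i₀)
      (f := fun t => cosWave r t * cosWave r t)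
      (Continuous.aestronglyMeasurable (by fun_prop))
  have hsum : ∑ m, W.coeff j (ridge i₀ r) m * W.coeff j (ridge i₀ r) m ≤ 1 / 4 := by
    simp_rw [coeff_eq, waveletCoeff_ridge, gen_false, ← Finset.prod_mul_distrib]
    have := Finset.prod_univ_sum (fun _ : Fin d => (Finset.univ : Finset (Fin (2 ^ j))))
      fun i k => (∫ t, cosWave (if i = i₀ then r else 0) t * W.φ.level S j k t ∂unitVol)
        * ∫ t, cosWave (if i = i₀ then r else 0) t * W.φ.level S j k t ∂unitVol
    rw [Fintype.piFinset_univ] at this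
    rw [← this]
    calc _ ≤ ∏ i, if i = i₀ then (1 / 4 : ℝ) else 1 := by
          refine Finset.prod_le_prod
            (fun i _ => Finset.sum_nonneg fun k _ => mul_self_nonneg _) fun i _ => ?_
          simp_rw [← sq]
          split_ifs with hi
          · exact hr
          · refine ((W.orthonormalFamily_φ hj).sum_sq_le (memLp_cosWave 0 2)).trans (le_of_eq ?_)
            simp [cosWave]
      _ = 1 / 4 := by
          rw [Finset.prod_ite_eq' Finset.univ i₀ fun _ => (1 / 4 : ℝ),
            if_pos (Finset.mem_univ _)]
  rw [residual, hint]
  linarith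

lemma residual_add_smul (j : ℕ) {p b g : (Fin d → ℝ) → ℝ} (hp : MemLp p 2 (cubeVol d))
    (hb : MemLp b 2 (cubeVol d)) (hg : MemLp g 2 (cubeVol d)) (s t : ℝ) :
    W.residual j (fun x => p x + s * g x) (fun x => b x + t * g x)
      = W.residual j p b + t * W.residual j p g + s * W.residual j g b
        + s * t * W.residual j g g := by
  have h1 : ∫ x, (p x + s * g x) * (b x + t * g x) ∂cubeVol d
      = ∫ x, p x * b x ∂cubeVol d + t * ∫ x, p x * g x ∂cubeVol d
        + s * ∫ x, g x * b x ∂cubeVol d + s * t * ∫ x, g x * g x ∂cubeVol d := by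
    have i1 : Integrable (fun x => p x * b x) (cubeVol d) := hp.integrable_mul hb
    have i2 : Integrable (fun x => t * (p x * g x)) (cubeVol d) :=
      (hp.integrable_mul hg).const_mul t
    have i3 : Integrable (fun x => s * (g x * b x)) (cubeVol d) :=
      (hg.integrable_mul hb).const_mul s
    have i4 : Integrable (fun x => s * t * (g x * g x)) (cubeVol d) :=
      (hg.integrable_mul hg).const_mul (s * t)
    have i12 : Integrable (fun x => p x * b x + t * (p x * g x)) (cubeVol d) := i1.add i2
    have i123 : Integrable (fun x => p x * b x + t * (p x * g x) + s * (g x * b x))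
        (cubeVol d) := i12.add i3
    simp_rw [← integral_const_mul]
    rw [← integral_add i1 i2, ← integral_add i12 i3, ← integral_add i123 i4]
    congr 1; ext x; ring
  have h2 : ∀ (f : (Fin d → ℝ) → ℝ) (hf : MemLp f 2 (cubeVol d)) (a : ℝ) m,
      W.coeff j (fun x => f x + a * g x) m = W.coeff j f m + a * W.coeff j g m := by
    intro f hf a m
    simp_rw [coeff_eq]
    exact W.waveletCoeff_add_smul j _ hf hg a m
  simp only [residual, h1, h2 p hp, h2 b hb, mul_sub, Finset.mul_sum]
  have h3 : ∑ m, (W.coeff j p m + s * W.coeff j g m) * (W.coeff j b m + t * W.coeff j g m)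
      = ∑ m, W.coeff j p m * W.coeff j b m + ∑ m, t * (W.coeff j p m * W.coeff j g m)
        + ∑ m, s * (W.coeff j g m * W.coeff j b m)
        + ∑ m, s * t * (W.coeff j g m * W.coeff j g m) := by
    rw [← Finset.sum_add_distrib, ← Finset.sum_add_distrib, ← Finset.sum_add_distrib]
    exact Finset.sum_congr rfl fun m _ => by ring
  rw [h3]
  ring

/-- For one of the four choices of signs, the perturbed pair has a residual that is at least that
of the perturbations alone. -/
lemma exists_signs_residual_ge (j : ℕ) {p b g : (Fin d → ℝ) → ℝ} (hp : MemLp p 2 (cubeVol d))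
    (hb : MemLp b 2 (cubeVol d)) (hg : MemLp g 2 (cubeVol d)) (s t : ℝ) :
    ∃ s' t' : ℝ, |s'| = |s| ∧ |t'| = |t| ∧ s * t * W.residual j g g
      ≤ |W.residual j (fun x => p x + s' * g x) (fun x => b x + t' * g x)| := by
  by_contra hcon
  push Not at hcon
  have h1 := abs_lt.1 (hcon s t rfl rfl)
  have h2 := abs_lt.1 (hcon (-s) t (abs_neg s) rfl)
  have h3 := abs_lt.1 (hcon s (-t) rfl (abs_neg t))
  have h4 := abs_lt.1 (hcon (-s) (-t) (abs_neg s) (abs_neg t))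
  rw [W.residual_add_smul j hp hb hg] at h1 h2 h3 h4
  linarith [h1.2, h2.1, h3.1, h4.2]

end CDVBasis

/-! ### Laws in the model -/

section Model

variable {S d : ℕ} {W : CDVBasis S} {α β M C₁ C₂ : ℝ}

lemma abs_le_of_mem_Icc {x : ℝ} (hx : x ∈ Set.Icc C₁ C₂) : |x| ≤ max |C₁| |C₂| :=
  abs_le_max_abs_abs hx.1 hx.2

namespace InModel

variable {P : Measure (Obs d)}

lemma isRegression_A (h : InModel W α β M C₁ C₂ P) {p : (Fin d → ℝ) → ℝ}
    (hp : p ∈ W.holderBall d α M) (hA : P[Obs.A | Obs.sigmaX d] =ᵐ[P] fun o => p o.X) :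
    IsRegression P (max |C₁| |C₂|) Obs.A p where
  measurable := Obs.measurable_A
  bound := h.bounded.mono fun _ ho => abs_le_of_mem_Icc ho.1
  aestronglyMeasurable := (CDVBasis.memLp_of_uniformContinuousOn hp.1 2).1
  condExp := hA

lemma isRegression_Y (h : InModel W α β M C₁ C₂ P) {b : (Fin d → ℝ) → ℝ}
    (hb : b ∈ W.holderBall d β M) (hY : P[Obs.Y | Obs.sigmaX d] =ᵐ[P] fun o => b o.X) :
    IsRegression P (max |C₁| |C₂|) Obs.Y b where
  measurable := Obs.measurable_Y
  bound := h.bounded.mono fun _ ho => abs_le_of_mem_Icc ho.2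
  aestronglyMeasurable := (CDVBasis.memLp_of_uniformContinuousOn hb.1 2).1
  condExp := hY

end InModel

/-- The nearest point of the cube. -/
def clampCube (x : Fin d → ℝ) : Fin d → ℝ := fun i => max 0 (min 1 (x i))

lemma continuous_clampCube : Continuous (clampCube (d := d)) := by
  unfold clampCube; fun_prop

lemma clampCube_mem (x : Fin d → ℝ) : clampCube x ∈ Set.Icc (0 : Fin d → ℝ) 1 :=
  ⟨fun _ => le_max_left _ _, fun _ => max_le zero_le_one (min_le_left _ _)⟩

lemma clampCube_of_mem {x : Fin d → ℝ} (hx : x ∈ Set.Icc (0 : Fin d → ℝ) 1) :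
    clampCube x = x := by
  ext i
  have h0 : 0 ≤ x i := hx.1 i
  have h1 : x i ≤ 1 := hx.2 i
  simp [clampCube, h0, h1]

/-- The conditional expectation of a variable that is a continuous function of the covariates. -/
lemma condExp_of_comp_X {P : Measure (Obs d)} [IsProbabilityMeasure P]
    (hU : P.map Obs.X = cubeVol d) {Z : Obs d → ℝ} {f : (Fin d → ℝ) → ℝ}
    (hf : ContinuousOn f (Set.Icc 0 1)) (hZf : ∀ᵐ o ∂P, Z o = f (clampCube o.X)) :
    P[Z | Obs.sigmaX d] =ᵐ[P] fun o => f o.X := by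
  have hc : Continuous fun x => f (clampCube x) :=
    hf.comp_continuous continuous_clampCube clampCube_mem
  have hs : StronglyMeasurable[Obs.sigmaX d] fun o : Obs d => f (clampCube o.X) :=
    (hc.measurable.comp (comap_measurable Obs.X)).stronglyMeasurable
  obtain ⟨K, hK⟩ := isCompact_Icc.exists_bound_of_continuousOn hf
  have hi : Integrable (fun o : Obs d => f (clampCube o.X)) P :=
    Integrable.of_bound (hs.mono (sigmaX_le d)).aestronglyMeasurable K
      (.of_forall fun o => hK _ (clampCube_mem _))
  have hX : ∀ᵐ o : Obs d ∂P, o.X ∈ Set.Icc (0 : Fin d → ℝ) 1 := by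
    have := CDVBasis.ae_mem_cube (d := d)
    rw [← hU] at this
    exact ae_of_ae_map Obs.measurable_X.aemeasurable this
  refine (condExp_congr_ae hZf).trans ?_
  rw [condExp_of_stronglyMeasurable (sigmaX_le d) hs hi]
  filter_upwards [hX] with o ho
  rw [clampCube_of_mem ho]

/-- Any two regression functions with values in `[C₁, C₂]` are attained, by the law under which the
treatment and the outcome are functions of the covariates. -/
lemma exists_inModel {p b : (Fin d → ℝ) → ℝ} (hp : p ∈ W.holderBall d α M)
    (hb : b ∈ W.holderBall d β M) (hpC : ∀ x ∈ Set.Icc (0 : Fin d → ℝ) 1, p x ∈ Set.Icc C₁ C₂)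
    (hbC : ∀ x ∈ Set.Icc (0 : Fin d → ℝ) 1, b x ∈ Set.Icc C₁ C₂) :
    ∃ P : Measure (Obs d), InModel W α β M C₁ C₂ P ∧
      P[Obs.A | Obs.sigmaX d] =ᵐ[P] (fun o => p o.X) ∧
      P[Obs.Y | Obs.sigmaX d] =ᵐ[P] fun o => b o.X := by
  have hpc : Measurable fun x => p (clampCube x) :=
    (hp.1.continuousOn.comp_continuous continuous_clampCube clampCube_mem).measurable
  have hbc : Measurable fun x => b (clampCube x) :=
    (hb.1.continuousOn.comp_continuous continuous_clampCube clampCube_mem).measurable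
  set T : (Fin d → ℝ) → Obs d := fun x => (x, p (clampCube x), b (clampCube x)) with hT
  have hTm : Measurable T := measurable_id.prodMk (hpc.prodMk hbc)
  set P := (cubeVol d).map T with hP
  have : IsProbabilityMeasure P := Measure.isProbabilityMeasure_map hTm.aemeasurable
  have hU : P.map Obs.X = cubeVol d := by
    rw [hP, Measure.map_map Obs.measurable_X hTm]
    exact Measure.map_id
  have hA : ∀ᵐ o ∂P, Obs.A o = p (clampCube o.X) := by
    exact (ae_map_iff hTm.aemeasurable (measurableSet_eq_fun Obs.measurable_A
      (hpc.comp Obs.measurable_X))).2 (.of_forall fun x => rfl)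
  have hY : ∀ᵐ o ∂P, Obs.Y o = b (clampCube o.X) := by
    exact (ae_map_iff hTm.aemeasurable (measurableSet_eq_fun Obs.measurable_Y
      (hbc.comp Obs.measurable_X))).2 (.of_forall fun x => rfl)
  have hA' := condExp_of_comp_X hU hp.1.continuousOn hA
  have hY' := condExp_of_comp_X hU hb.1.continuousOn hY
  refine ⟨P, ⟨this, hU, ?_, ⟨p, hp, hA'⟩, ⟨b, hb, hY'⟩⟩, hA', hY'⟩
  filter_upwards [hA, hY] with o h1 h2
  rw [h1, h2]
  exact ⟨hpC _ (clampCube_mem _), hbC _ (clampCube_mem _)⟩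

lemma rate_eq (hd : 1 ≤ d) (j : ℕ) (γ : ℝ) :
    ((2 : ℝ) ^ (j * d)) ^ (-γ / (d : ℝ)) = ((2 : ℝ) ^ (-γ)) ^ j := by
  have : (d : ℝ) ≠ 0 := by positivity
  rw [← Real.rpow_natCast 2 (j * d), ← Real.rpow_mul two_pos.le, ← Real.rpow_natCast _ j,
    ← Real.rpow_mul two_pos.le]
  congr 1
  push_cast
  field_simp

lemma worstBias_ge (hd : 1 ≤ d) (hα : 0 < α) (hβ : 0 < β) (hαS : α < S) (hβS : β < S)
    (hM : 0 < M) (hN : Nondegenerate W d α β M C₁ C₂) :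
    ∃ c : ℝ, 0 < c ∧ ∀ n : ℕ, 1 ≤ n → ∀ j : ℕ, W.J₀ ≤ j →
      ENNReal.ofReal (c * ((2 : ℝ) ^ (-(α + β))) ^ j) ≤ worstBias W d α β M C₁ C₂ j n := by
  obtain ⟨M', hM', δ, hδ, ⟨p, hp, hpC⟩, ⟨b, hb, hbC⟩⟩ := hN
  set i₀ : Fin d := ⟨0, hd⟩
  obtain ⟨η₁, hη₁, h₁⟩ := W.exists_perturbation hα hαS hM hM' i₀ hp
  obtain ⟨η₂, hη₂, h₂⟩ := W.exists_perturbation hβ hβS hM hM' i₀ hb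
  set η := min δ (min η₁ η₂) with hη
  have hη0 : 0 < η := lt_min hδ (lt_min hη₁ hη₂)
  have hηδ : η ≤ δ := min_le_left _ _
  refine ⟨η ^ 2 / 4, by positivity, fun n hn j hj => ?_⟩
  obtain ⟨r, hr, hres⟩ := W.exists_ridge_residual_ge hj i₀
  have h2j : (1 : ℝ) ≤ 2 ^ j := one_le_pow₀ one_le_two
  set s := η / ((2 : ℝ) ^ j) ^ α with hs
  set t := η / ((2 : ℝ) ^ j) ^ β with ht
  have hα1 : 1 ≤ ((2 : ℝ) ^ j) ^ α := Real.one_le_rpow h2j hα.le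
  have hβ1 : 1 ≤ ((2 : ℝ) ^ j) ^ β := Real.one_le_rpow h2j hβ.le
  have hs0 : 0 ≤ s := by positivity
  have ht0 : 0 ≤ t := by positivity
  obtain ⟨s', t', hs', ht', hst⟩ := W.exists_signs_residual_ge j
    (CDVBasis.memLp_of_uniformContinuousOn hp.1 2) (CDVBasis.memLp_of_uniformContinuousOn hb.1 2)
    (CDVBasis.memLp_ridge i₀ r 2) s t
  rw [abs_of_nonneg hs0] at hs'
  rw [abs_of_nonneg ht0] at ht'
  have hvalues : ∀ {f : (Fin d → ℝ) → ℝ} {a : ℝ}, |a| ≤ δ →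
      (∀ x ∈ Set.Icc (0 : Fin d → ℝ) 1, f x ∈ Set.Icc (C₁ + δ) (C₂ - δ)) →
      ∀ x ∈ Set.Icc (0 : Fin d → ℝ) 1, f x + a * CDVBasis.ridge i₀ r x ∈ Set.Icc C₁ C₂ := by
    intro f a ha hf x hx
    have h1 : |a * CDVBasis.ridge i₀ r x| ≤ δ := by
      rw [abs_mul]
      exact (mul_le_of_le_one_right (abs_nonneg _) (abs_cosWave_le r (x i₀))).trans ha
    have h2 := abs_le.1 h1
    have h3 := hf x hx
    exact ⟨by linarith [h3.1], by linarith [h3.2]⟩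
  have hp' := h₁ j r hj hr s' (by
    rw [hs', hs, div_mul_cancel₀ _ (by positivity)]
    exact (min_le_right _ _).trans (min_le_left _ _))
  have hb' := h₂ j r hj hr t' (by
    rw [ht', ht, div_mul_cancel₀ _ (by positivity)]
    exact (min_le_right _ _).trans (min_le_right _ _))
  obtain ⟨P, hP, hA, hY⟩ := exists_inModel (C₁ := C₁) (C₂ := C₂) hp' hb'
    (hvalues (by rw [hs']; exact (div_le_self hη0.le hα1).trans hηδ) hpC)
    (hvalues (by rw [ht']; exact (div_le_self hη0.le hβ1).trans hηδ) hbC)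
  have := hP.prob
  have hbias := biasNR_eq hP.uniform (hP.isRegression_A hp' hA) (hP.isRegression_Y hb' hY) hj hn
  refine le_iSup₂_of_le P hP (ENNReal.ofReal_le_ofReal ?_)
  rw [hbias]
  refine le_trans ?_ hst
  have e : η ^ 2 / 4 * ((2 : ℝ) ^ (-(α + β))) ^ j = s * t * (1 / 4) := by
    have : ((2 : ℝ) ^ (-(α + β))) ^ j = (((2 : ℝ) ^ j) ^ α * ((2 : ℝ) ^ j) ^ β)⁻¹ := by
      rw [← Real.rpow_add (by positivity), ← Real.rpow_neg (by positivity),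
        ← Real.rpow_natCast, ← Real.rpow_natCast, ← Real.rpow_mul two_pos.le,
        ← Real.rpow_mul two_pos.le, mul_comm]
    rw [this, hs, ht]
    field_simp
  rw [e]
  exact mul_le_mul_of_nonneg_left hres (by positivity)

end Model

end

/-! ### Rates of the estimator -/

theorem theorem3 (d S : ℕ) (hd : 1 ≤ d) (W : CDVBasis S) (α β M C₁ C₂ : ℝ)
    (hα : 0 < α) (hβ : 0 < β) (hαS : α < S) (hβS : β < S) (hM : 0 < M) :
    -- the estimator has finite second moments under the model
    (∀ P : Measure (Obs d), InModel W α β M C₁ C₂ P → ∀ n : ℕ, 1 ≤ n → ∀ j : ℕ, W.J₀ ≤ j →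
      MemLp (psiNR W j n) 2 (sampleLaw P n)) ∧
    -- upper bound on the worst-case bias, with k = 2 ^ (j * d)
    (∃ C : ℝ, 0 < C ∧ ∀ n : ℕ, 1 ≤ n → ∀ j : ℕ, W.J₀ ≤ j →
      worstBias W d α β M C₁ C₂ j n ≤
        ENNReal.ofReal (C * ((2 : ℝ) ^ (j * d)) ^ (-(α + β) / (d : ℝ)))) ∧
    -- lower bound on the worst-case bias
    (Nondegenerate W d α β M C₁ C₂ →
      ∃ c : ℝ, 0 < c ∧ ∀ n : ℕ, 1 ≤ n → ∀ j : ℕ, W.J₀ ≤ j →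
        ENNReal.ofReal (c * ((2 : ℝ) ^ (j * d)) ^ (-(α + β) / (d : ℝ))) ≤
          worstBias W d α β M C₁ C₂ j n) ∧
    -- upper bound on the worst-case variance
    (∃ C : ℝ, 0 < C ∧ ∀ n : ℕ, 1 ≤ n → ∀ j : ℕ, W.J₀ ≤ j →
      worstVariance W d α β M C₁ C₂ j n ≤
        ENNReal.ofReal (C * (1 / (n : ℝ) + (2 : ℝ) ^ (j * d) / (n : ℝ) ^ 2))) := by
  have hS : 0 < S := by exact_mod_cast hα.trans hαS
  simp_rw [rate_eq hd]
  refine ⟨fun P hP n _ j _ => ?_, ?_, worstBias_ge hd hα hβ hαS hβS hM, ?_⟩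
  · have := hP.prob
    obtain ⟨p, hp, hA⟩ := hP.reg_A
    obtain ⟨b, hb, hY⟩ := hP.reg_Y
    exact memLp_psiNR (hP.isRegression_A hp hA) (hP.isRegression_Y hb hY) j n
  · have hq : (2 : ℝ) ^ (-(α + β)) < 1 :=
      Real.rpow_lt_one_of_one_lt_of_neg one_lt_two (by linarith)
    refine ⟨2 ^ d * M ^ 2 / (1 - 2 ^ (-(α + β))), ?_, fun n hn j hj => iSup₂_le fun P hP => ?_⟩
    · have := sub_pos.2 hq
      positivity
    have := hP.prob
    obtain ⟨p, hp, hA⟩ := hP.reg_A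
    obtain ⟨b, hb, hY⟩ := hP.reg_Y
    rw [biasNR_eq hP.uniform (hP.isRegression_A hp hA) (hP.isRegression_Y hb hY) hj hn]
    exact ENNReal.ofReal_le_ofReal (W.abs_residual_le hS hα hβ hM.le hp hb hj)
  · refine ⟨5 * max |C₁| |C₂| ^ 4 + 1, by positivity,
      fun n hn j hj => iSup₂_le fun P hP => ?_⟩
    have := hP.prob
    obtain ⟨p, hp, hA⟩ := hP.reg_A
    obtain ⟨b, hb, hY⟩ := hP.reg_Y
    have hpR := hP.isRegression_A hp hA
    have hbR := hP.isRegression_Y hb hY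
    rw [← ofReal_variance (memLp_psiNR hpR hbR j n)]
    refine ENNReal.ofReal_le_ofReal ((variance_psiNR_le hP.uniform hpR hbR hj hn).trans ?_)
    gcongr
    exact le_add_of_nonneg_right zero_le_one
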